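/- **Theorem (Completeness).** Consider the Central Submonad Calculus (CSC): the simply-typed $\lambda$-calculus with types $1$, $A\to B$, $A\times B$, $\mathcal S A$, $\mathcal T A$ and, besides the usual terms, the terms $\mathtt{ret}_{\mathcal X}M$ and $\mathtt{do}_{\mathcal X}\,x\leftarrow M;N$ for $\mathcal X\in\{\mathcal S,\mathcal T\}$, and $\iota M:\mathcal T A$ for $M:\mathcal S A$. Judgements are closed under conversion along type equality. Equality of terms is the congruence generated by the $\beta\eta$-rules of the simply-typed $\lambda$-calculus with unit and products; the laws $\mathtt{do}_{\mathcal X}\,x\leftarrow\mathtt{ret}_{\mathcal X}M;N=N[M/x]$, $\mathtt{do}_{\mathcal X}\,x\leftarrow M;\mathtt{ret}_{\mathcal X}x=M$ and $\mathtt{do}_{\mathcal X}\,y\leftarrow(\mathtt{do}_{\mathcal X}\,x\leftarrow M;N);P=\mathtt{do}_{\mathcal X}\,x\leftarrow M;\mathtt{do}_{\mathcal X}\,y\leftarrow N;P$ ($x$ not free in $P$); $\iota\,\mathtt{ret}_{\mathcal S}M=\mathtt{ret}_{\mathcal T}M$; $\mathtt{do}_{\mathcal T}\,x\leftarrow\iota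 M;\iota N=\iota(\mathtt{do}_{\mathcal S}\,x\leftarrow M;N)$; for $M,N:\mathcal S A$, $\iota M=\iota N$ iff $M=N$; and centrality, $\mathtt{do}_{\mathcal T}\,x\leftarrow\iota M;\mathtt{do}_{\mathcal T}\,y\leftarrow N;P=\mathtt{do}_{\mathcal T}\,y\leftarrow N;\mathtt{do}_{\mathcal T}\,x\leftarrow\iota M;P$ ($x$ not free in $N$, $y$ not free in $M$). A *CSC-theory* $\mathfrak{Th}$ extends this calculus by ground types, typed term constants, equalities between types, and equalities between well-formed terms of the same type in the same context. A *CSC-model* is a cartesian closed category with a strong monad $\mathcal T$ (for the cartesian structure), a strong monad $\mathcal S$ and a monomorphism of strong monads $\iota:\mathcal S\Rightarrow\mathcal T$ such that every $(\mathcal S X,\iota_X)$ is a central cone of $\mathcal T$ at $X$, i.e. for every $Y$ the two morphisms $\mu\circ\mathcal T\tau'\circ\tau$ and $\mu\circ\mathcal T\tau\circ\tau'$ from $\mathcal T X\times\mathcal T Y$ to $\mathcal T(X\times Y)$ agree after precomposition with $\iota_X\times\mathcal T Y$, where $\tau$ and $\tau'$ are the left and right strengths. Let $\mathfrak{Th}$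 be a CSC-theory, and let $S(\mathfrak{Th})$ be the category whose objects are the classes $[A]$ of types modulo provable equality and whose morphisms $[A]\to[B]$ are the classes $[x:A\vdash f:B]$ of judgements modulo provable equality of types and terms, with identities $[x:A\vdash x:A]$ and composition by substitution. Then $S(\mathfrak{Th})$ is cartesian closed, with $1=[1]$, $[A]\times[B]=[A\times B]$ and exponential $[A\to B]$, and with projections $[x:A_1\times A_2\vdash\pi_i x:A_i]$ and evaluation given by application. For $\mathcal X\in\{\mathcal S,\mathcal T\}$ the assignments $$\mathcal X([A])=[\mathcal X A],\qquad \mathcal X([x:A\vdash f:B])=[y:\mathcal X A\vdash\mathtt{do}_{\mathcal X}\,x\leftarrow y;\mathtt{ret}_{\mathcal X}f:\mathcal X B],$$ $$\eta_{[A]}=[x:A\vdash\mathtt{ret}_{\mathcal X}x:\mathcal X A],\qquad \mu_{[A]}=[x:\mathcal X\mathcal X A\vdash\mathtt{do}_{\mathcal X}\,y\leftarrow x;y:\mathcal X A],$$ $$\tau_{[A],[B]}=[x:A\times\mathcal X B\vdash\mathtt{do}_{\mathcal X}\,y\leftarrow\pi_2x;\mathtt{ret}_{\mathcal X}\langle\pi_1x,y\rangle:\mathcal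 X(A\times B)]$$ define strong monads on $S(\mathfrak{Th})$, and $\iota_{[A]}=[x:\mathcal S A\vdash\iota x:\mathcal T A]$ is a componentwise monic morphism of strong monads that makes $\mathcal S$ a central submonad of $\mathcal T$. Thus $(S(\mathfrak{Th}),\mathcal T,\mathcal S,\iota)$ is a CSC-model. There is exactly one interpretation $[\![-]\!]$ of $\mathfrak{Th}$ in this model (types go to objects and well-formed terms $\Gamma\vdash M:A$ to morphisms $[\![\Gamma]\!]\to[\![A]\!]$, compatibly with type conversion and according to the structure of types and terms, with $[\![\mathtt{ret}_{\mathcal X}M]\!]=\eta\circ[\![M]\!]$, $[\![\iota M]\!]=\iota\circ[\![M]\!]$ and $[\![\mathtt{do}_{\mathcal X}\,x\leftarrow M;N]\!]=\mu\circ\mathcal X[\![N]\!]\circ\tau\circ\langle\mathrm{id},[\![M]\!]\rangle$) that sends each ground type $G$ to $[G]$ and each constant $c:A$ to $[x:1\vdash c:A]$. This interpretation is sound and complete: $\vdash A=B:\mathtt{type}$ holds in $\mathfrak{Th}$ iff $[\![A]\!]=[\![B]\!]$, and, for well-formed terms $\Gamma\vdash M:A$ and $\Gamma\vdash N:A$,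 $\Gamma\vdash M=N:A$ holds in $\mathfrak{Th}$ iff $[\![\Gamma\vdash M:A]\!]=[\![\Gamma\vdash N:A]\!]$. -/

import Mathlib

universe u v w t

open CategoryTheory MonoidalCategory CartesianMonoidalCategory

namespace CSC

/-! ## Syntax -/

/-- The two monadic modalities: `S` (central computations) and `T` (all computations).
A rule stated for a variable `m : Mode` is a rule stated for both. -/
inductive Mode : Type
  | S
  | T

/-- Types: ground types, `1`, `A → B`, `A × B`, and `mon m A`, which is `S A` or `T A`. -/
inductive Ty (G : Type u) : Type u
  | ground (g : G) : Ty G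
  | one : Ty G
  | arrow (A B : Ty G) : Ty G
  | prod (A B : Ty G) : Ty G
  | mon (m : Mode) (A : Ty G) : Ty G

/-- Terms up to α-equivalence, with de Bruijn indices. `lam A M` binds variable `0` of `M`, and
`bind m M N` is `do_m x ← M; N`, where `x` is variable `0` of `N`. -/
inductive Tm (G : Type u) (K : Type v) : Type (max u v)
  | var (n : ℕ) : Tm G K
  | const (c : K) : Tm G K
  | star : Tm G K
  | lam (A : Ty G) (M : Tm G K) : Tm G K
  | app (M N : Tm G K) : Tm G K
  | pair (M N : Tm G K) : Tm G K
  | fst (M : Tm G K) : Tm G K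
  | snd (M : Tm G K) : Tm G K
  | ret (m : Mode) (M : Tm G K) : Tm G K
  | iota (M : Tm G K) : Tm G K
  | bind (m : Mode) (M N : Tm G K) : Tm G K

/-- A context: the type of variable `n` is the `n`-th entry. -/
abbrev Ctx (G : Type u) : Type u := List (Ty G)

/-- Lift a renaming under a binder. -/
def upRen (ρ : ℕ → ℕ) : ℕ → ℕ
  | 0 => 0
  | n + 1 => ρ n + 1

/-- Exchange the two most recently bound variables. -/
def swapRen : ℕ → ℕ
  | 0 => 1
  | 1 => 0
  | n + 2 => n + 2

namespace Tm

variable {G : Type u} {K : Type v}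

/-- Renaming of variables. -/
def ren (ρ : ℕ → ℕ) : Tm G K → Tm G K
  | var n => var (ρ n)
  | const c => const c
  | star => star
  | lam A M => lam A (M.ren (upRen ρ))
  | app M N => app (M.ren ρ) (N.ren ρ)
  | pair M N => pair (M.ren ρ) (N.ren ρ)
  | fst M => fst (M.ren ρ)
  | snd M => snd (M.ren ρ)
  | ret m M => ret m (M.ren ρ)
  | iota M => iota (M.ren ρ)
  | bind m M N => bind m (M.ren ρ) (N.ren (upRen ρ))

/-- Weakening by one fresh (most recent) variable. -/
def wk (M : Tm G K) : Tm G K := M.ren Nat.succ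

/-- Lift a substitution under a binder. -/
def up (σ : ℕ → Tm G K) : ℕ → Tm G K
  | 0 => var 0
  | n + 1 => (σ n).wk

/-- Simultaneous capture-avoiding substitution. -/
def sub (σ : ℕ → Tm G K) : Tm G K → Tm G K
  | var n => σ n
  | const c => const c
  | star => star
  | lam A M => lam A (M.sub (up σ))
  | app M N => app (M.sub σ) (N.sub σ)
  | pair M N => pair (M.sub σ) (N.sub σ)
  | fst M => fst (M.sub σ)
  | snd M => snd (M.sub σ)
  | ret m M => ret m (M.sub σ)
  | iota M => iota (M.sub σ)
  | bind m M N => bind m (M.sub σ) (N.sub (up σ))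

/-- The substitution sending variable `0` to `M` and removing it from the context. -/
def instSub (M : Tm G K) : ℕ → Tm G K
  | 0 => M
  | n + 1 => var n

/-- `N.inst M` is `N[M/x]` in context `Γ`, where `N` lives in `Γ, x` and `M` in `Γ`. -/
def inst (N M : Tm G K) : Tm G K := N.sub (instSub M)

/-- The substitution sending variable `0` to `M` and leaving the others alone. -/
def headSub (M : Tm G K) : ℕ → Tm G K
  | 0 => M
  | n + 1 => var (n + 1)

/-- `N.replace M` is `N[M/y]`, for terms `y ⊢ N` and `x ⊢ M` in one variable each;
the result is a term in the variable `x`. -/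
def replace (N M : Tm G K) : Tm G K := N.sub (headSub M)

theorem upRen_comp (ρ ρ' : ℕ → ℕ) : upRen ρ' ∘ upRen ρ = upRen (ρ' ∘ ρ) := by
  funext n; cases n <;> rfl

theorem ren_ren (M : Tm G K) : ∀ (ρ ρ' : ℕ → ℕ), (M.ren ρ).ren ρ' = M.ren (ρ' ∘ ρ) := by
  induction M <;> intro ρ ρ' <;> simp_all [ren, upRen_comp]

theorem up_comp_upRen (ρ : ℕ → ℕ) (σ : ℕ → Tm G K) : up σ ∘ upRen ρ = up (σ ∘ ρ) := by
  funext n; cases n <;> rfl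

theorem sub_ren (M : Tm G K) : ∀ (ρ : ℕ → ℕ) (σ : ℕ → Tm G K),
    (M.ren ρ).sub σ = M.sub (σ ∘ ρ) := by
  induction M <;> intro ρ σ <;> simp_all [ren, sub, up_comp_upRen]

theorem ren_up (ρ : ℕ → ℕ) (σ : ℕ → Tm G K) :
    (fun n => (up σ n).ren (upRen ρ)) = up (fun n => (σ n).ren ρ) := by
  funext n
  cases n with
  | zero => rfl
  | succ n =>
    simp only [up, wk, ren_ren]
    rfl

theorem ren_sub (M : Tm G K) : ∀ (σ : ℕ → Tm G K) (ρ : ℕ → ℕ),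
    (M.sub σ).ren ρ = M.sub (fun n => (σ n).ren ρ) := by
  induction M <;> intro σ ρ <;> simp_all [ren, sub, ren_up]

theorem sub_up (σ τ : ℕ → Tm G K) :
    (fun n => (up σ n).sub (up τ)) = up (fun n => (σ n).sub τ) := by
  funext n
  cases n with
  | zero => rfl
  | succ n =>
    simp only [up, wk, sub_ren, ren_sub]
    rfl

theorem sub_sub (M : Tm G K) : ∀ (σ τ : ℕ → Tm G K),
    (M.sub σ).sub τ = M.sub (fun n => (σ n).sub τ) := by
  induction M <;> intro σ τ <;> simp_all [sub, sub_up]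

theorem up_var : up (var : ℕ → Tm G K) = var := by
  funext n; cases n <;> rfl

theorem sub_var (M : Tm G K) : M.sub var = M := by
  induction M <;> simp_all [sub, up_var]

theorem upRen_id : upRen id = id := by
  funext n; cases n <;> rfl

theorem ren_id (M : Tm G K) : M.ren id = M := by
  induction M <;> simp_all [ren, upRen_id]

theorem replace_var (M : Tm G K) : M.replace (var 0) = M := by
  have h : headSub (var 0 : Tm G K) = var := by funext n; cases n <;> rfl
  rw [replace, h, sub_var]

theorem replace_replace (P N M : Tm G K) :
    (P.replace N).replace M = P.replace (N.replace M) := by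
  simp only [replace, sub_sub]
  congr 1
  funext n; cases n <;> rfl

theorem inst_ren_upRen (N M : Tm G K) : (N.ren (upRen Nat.succ)).inst M = N.replace M := by
  simp only [inst, replace, sub_ren]
  congr 1
  funext n; cases n <;> rfl

end Tm

/-! ## Theories -/

/-- Ground types, type equality axioms, and typed constants. -/
structure Signature where
  Ground : Type u
  Const : Type v
  constTy : Const → Ty Ground
  tyAx : Ty Ground → Ty Ground → Prop

/-- The judgement `⊢ A = B : type`. -/
inductive TyEq (Sg : Signature.{u, v}) : Ty Sg.Ground → Ty Sg.Ground → Prop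
  | ax {A B} : Sg.tyAx A B → TyEq Sg A B
  | refl (A) : TyEq Sg A A
  | symm {A B} : TyEq Sg A B → TyEq Sg B A
  | trans {A B C} : TyEq Sg A B → TyEq Sg B C → TyEq Sg A C
  | prod {A A' B B'} : TyEq Sg A A' → TyEq Sg B B' → TyEq Sg (.prod A B) (.prod A' B')
  | arrow {A A' B B'} : TyEq Sg A A' → TyEq Sg B B' → TyEq Sg (.arrow A B) (.arrow A' B')
  | mon (m) {A B} : TyEq Sg A B → TyEq Sg (.mon m A) (.mon m B)

/-- Contexts that agree up to type equality. -/
def CtxEq (Sg : Signature.{u, v}) (Γ Δ : Ctx Sg.Ground) : Prop :=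
  List.Forall₂ (TyEq Sg) Γ Δ

/-- The judgement `Γ ⊢ M : A`. -/
inductive HasType (Sg : Signature.{u, v}) :
    Ctx Sg.Ground → Tm Sg.Ground Sg.Const → Ty Sg.Ground → Prop
  | var {Γ : Ctx Sg.Ground} {n A} : Γ[n]? = some A → HasType Sg Γ (.var n) A
  | const (Γ c) : HasType Sg Γ (.const c) (Sg.constTy c)
  | star (Γ) : HasType Sg Γ .star .one
  | lam {Γ A B M} : HasType Sg (A :: Γ) M B → HasType Sg Γ (.lam A M) (.arrow A B)
  | app {Γ A B M N} : HasType Sg Γ M (.arrow A B) → HasType Sg Γ N A →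
      HasType Sg Γ (.app M N) B
  | pair {Γ A B M N} : HasType Sg Γ M A → HasType Sg Γ N B →
      HasType Sg Γ (.pair M N) (.prod A B)
  | fst {Γ A B M} : HasType Sg Γ M (.prod A B) → HasType Sg Γ (.fst M) A
  | snd {Γ A B M} : HasType Sg Γ M (.prod A B) → HasType Sg Γ (.snd M) B
  | ret (m) {Γ A M} : HasType Sg Γ M A → HasType Sg Γ (.ret m M) (.mon m A)
  | iota {Γ A M} : HasType Sg Γ M (.mon .S A) → HasType Sg Γ (.iota M) (.mon .T A)
  | bind {m Γ A B M N} : HasType Sg Γ M (.mon m A) → HasType Sg (A :: Γ) N (.mon m B) →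
      HasType Sg Γ (.bind m M N) (.mon m B)
  | conv {Γ Δ M A B} : CtxEq Sg Γ Δ → TyEq Sg A B → HasType Sg Γ M A → HasType Sg Δ M B

/-- A CSC-theory: a signature together with equations between well-formed terms
(`ax Γ M N A` is the axiom `Γ ⊢ M = N : A`). -/
structure Theory extends Signature.{u, v} where
  ax : Ctx Ground → Tm Ground Const → Tm Ground Const → Ty Ground → Prop
  ax_left : ∀ {Γ M N A}, ax Γ M N A → HasType toSignature Γ M A
  ax_right : ∀ {Γ M N A}, ax Γ M N A → HasType toSignature Γ N A

/-- Types of a theory. -/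
abbrev Theory.Types (Th : Theory.{u, v}) : Type u := Ty Th.Ground

/-- Raw terms of a theory. -/
abbrev Theory.Terms (Th : Theory.{u, v}) : Type (max u v) := Tm Th.Ground Th.Const

/-- Contexts of a theory. -/
abbrev Theory.Ctxs (Th : Theory.{u, v}) : Type u := Ctx Th.Ground

/-- `Th.TyEq A B` is `⊢ A = B : type` in `Th`. -/
abbrev Theory.TyEq (Th : Theory.{u, v}) : Th.Types → Th.Types → Prop := CSC.TyEq Th.toSignature

/-- `Th.HasType Γ M A` is `Γ ⊢ M : A` in `Th`. -/
abbrev Theory.HasType (Th : Theory.{u, v}) : Th.Ctxs → Th.Terms → Th.Types → Prop :=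
  CSC.HasType Th.toSignature

/-- Contexts of `Th` that agree up to type equality. -/
abbrev Theory.CtxEq (Th : Theory.{u, v}) : Th.Ctxs → Th.Ctxs → Prop := CSC.CtxEq Th.toSignature

/-- The judgement `Γ ⊢ M = N : A` of a theory. -/
inductive TmEq (Th : Theory.{u, v}) : Th.Ctxs → Th.Terms → Th.Terms → Th.Types → Prop
  | ax {Γ M N A} : Th.ax Γ M N A → TmEq Th Γ M N A
  | conv {Γ Δ M N A B} : Th.CtxEq Γ Δ → Th.TyEq A B → TmEq Th Γ M N A → TmEq Th Δ M N B
  -- equivalence, weakening and permutation of contexts, substitution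
  | refl {Γ M A} : Th.HasType Γ M A → TmEq Th Γ M M A
  | symm {Γ M N A} : TmEq Th Γ M N A → TmEq Th Γ N M A
  | trans {Γ M N P A} : TmEq Th Γ M N A → TmEq Th Γ N P A → TmEq Th Γ M P A
  | ren {Γ Δ : Th.Ctxs} {M N A} (ρ : ℕ → ℕ) :
      (∀ (n : ℕ) (B : Th.Types), Γ[n]? = some B → Δ[ρ n]? = some B) →
      TmEq Th Γ M N A → TmEq Th Δ (M.ren ρ) (N.ren ρ) A
  | subst {Γ M N P A B} : Th.HasType Γ M A → TmEq Th (A :: Γ) N P B →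
      TmEq Th Γ (N.inst M) (P.inst M) B
  -- simply-typed lambda calculus
  | one_eta (Γ) : TmEq Th (.one :: Γ) .star (.var 0) .one
  | pair_eq {Γ M M' N N' A B} : TmEq Th Γ M M' A → TmEq Th Γ N N' B →
      TmEq Th Γ (.pair M N) (.pair M' N') (.prod A B)
  | fst_beta {Γ M N A B} : Th.HasType Γ M A → Th.HasType Γ N B →
      TmEq Th Γ (.fst (.pair M N)) M A
  | snd_beta {Γ M N A B} : Th.HasType Γ M A → Th.HasType Γ N B →
      TmEq Th Γ (.snd (.pair M N)) N B
  | prod_eta {Γ M A B} : Th.HasType Γ M (.prod A B) →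
      TmEq Th Γ (.pair (.fst M) (.snd M)) M (.prod A B)
  | app_eq {Γ M M' N N' A B} : TmEq Th Γ M M' (.arrow A B) → TmEq Th Γ N N' A →
      TmEq Th Γ (.app M N) (.app M' N') B
  | lam_eq {Γ M N A B} : TmEq Th (A :: Γ) M N B →
      TmEq Th Γ (.lam A M) (.lam A N) (.arrow A B)
  | lam_beta {Γ M N A B} : Th.HasType (A :: Γ) M B → Th.HasType Γ N A →
      TmEq Th Γ (.app (.lam A M) N) (M.inst N) B
  | lam_eta {Γ M A B} : Th.HasType Γ M (.arrow A B) →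
      TmEq Th Γ (.lam A (.app M.wk (.var 0))) M (.arrow A B)
  -- the two strong monads
  | ret_eq (m) {Γ M N A} : TmEq Th Γ M N A → TmEq Th Γ (.ret m M) (.ret m N) (.mon m A)
  | bind_eq {m Γ M M' N N' A B} : TmEq Th Γ M M' (.mon m A) →
      TmEq Th (A :: Γ) N N' (.mon m B) →
      TmEq Th Γ (.bind m M N) (.bind m M' N') (.mon m B)
  | bind_beta {m Γ M N A B} : Th.HasType Γ M A → Th.HasType (A :: Γ) N (.mon m B) →
      TmEq Th Γ (.bind m (.ret m M) N) (N.inst M) (.mon m B)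
  | bind_eta {m Γ M A} : Th.HasType Γ M (.mon m A) →
      TmEq Th Γ (.bind m M (.ret m (.var 0))) M (.mon m A)
  | bind_assoc {m Γ M N P A B C} : Th.HasType Γ M (.mon m A) →
      Th.HasType (A :: Γ) N (.mon m B) → Th.HasType (B :: Γ) P (.mon m C) →
      TmEq Th Γ (.bind m (.bind m M N) P)
        (.bind m M (.bind m N (P.ren (upRen Nat.succ)))) (.mon m C)
  -- the central submonad
  | central {Γ M N P A B C} : Th.HasType Γ M (.mon .S A) → Th.HasType Γ N (.mon .T B) →
      Th.HasType (B :: A :: Γ) P (.mon .T C) →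
      TmEq Th Γ (.bind .T (.iota M) (.bind .T N.wk P))
        (.bind .T N (.bind .T (.iota M.wk) (P.ren swapRen))) (.mon .T C)
  | iota_eq {Γ M N A} : TmEq Th Γ M N (.mon .S A) →
      TmEq Th Γ (.iota M) (.iota N) (.mon .T A)
  | iota_mono {Γ M N A} : Th.HasType Γ M (.mon .S A) → Th.HasType Γ N (.mon .S A) →
      TmEq Th Γ (.iota M) (.iota N) (.mon .T A) → TmEq Th Γ M N (.mon .S A)
  | iota_comp {Γ M N A B} : Th.HasType Γ M (.mon .S A) →
      Th.HasType (A :: Γ) N (.mon .S B) →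
      TmEq Th Γ (.bind .T (.iota M) (.iota N)) (.iota (.bind .S M N)) (.mon .T B)
  | iota_ret {Γ M A} : Th.HasType Γ M A →
      TmEq Th Γ (.iota (.ret .S M)) (.ret .T M) (.mon .T A)

/-- `Th.TmEq Γ M N A` is `Γ ⊢ M = N : A` in `Th`. -/
abbrev Theory.TmEq (Th : Theory.{u, v}) : Th.Ctxs → Th.Terms → Th.Terms → Th.Types → Prop :=
  CSC.TmEq Th

/-! ## Typing is stable under renaming and substitution -/

section Typing

variable {Sg : Signature.{u, v}}

theorem CtxEq.symm {Γ Δ : Ctx Sg.Ground} (h : CtxEq Sg Γ Δ) : CtxEq Sg Δ Γ := by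
  induction h with
  | nil => exact .nil
  | cons h _ ih => exact .cons h.symm ih

theorem CtxEq.refl (Γ : Ctx Sg.Ground) : CtxEq Sg Γ Γ := by
  induction Γ with
  | nil => exact .nil
  | cons A Γ ih => exact .cons (.refl A) ih

theorem CtxEq.lookup {Γ Δ : Ctx Sg.Ground} (h : CtxEq Sg Γ Δ) :
    ∀ {n : ℕ} {A : Ty Sg.Ground}, Γ[n]? = some A → ∃ B, Δ[n]? = some B ∧ TyEq Sg A B := by
  induction h with
  | nil => intro n A h; simp at h
  | cons hAB _ ih =>
    intro n A h
    cases n with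
    | zero =>
      simp only [List.getElem?_cons_zero, Option.some.injEq] at h
      subst h
      exact ⟨_, rfl, hAB⟩
    | succ n =>
      simp only [List.getElem?_cons_succ] at h ⊢
      exact ih h

theorem HasType.ren {Γ : Ctx Sg.Ground} {M A} (h : HasType Sg Γ M A) :
    ∀ {Δ : Ctx Sg.Ground} {ρ : ℕ → ℕ},
      (∀ n B, Γ[n]? = some B → ∃ B', Δ[ρ n]? = some B' ∧ TyEq Sg B' B) →
      HasType Sg Δ (M.ren ρ) A := by
  have up : ∀ {Γ Δ : Ctx Sg.Ground} {ρ : ℕ → ℕ} (A : Ty Sg.Ground),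
      (∀ n B, Γ[n]? = some B → ∃ B', Δ[ρ n]? = some B' ∧ TyEq Sg B' B) →
      ∀ n B, (A :: Γ)[n]? = some B → ∃ B', (A :: Δ)[upRen ρ n]? = some B' ∧ TyEq Sg B' B := by
    intro Γ Δ ρ A hρ n B hn
    cases n with
    | zero => exact ⟨B, hn, .refl B⟩
    | succ n => exact hρ n B hn
  induction h with
  | var h =>
    intro Δ ρ hρ
    obtain ⟨B', h1, h2⟩ := hρ _ _ h
    exact .conv (CtxEq.refl _) h2 (.var h1)
  | const Γ c => intro Δ ρ _; exact .const _ _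
  | star Γ => intro Δ ρ _; exact .star _
  | lam _ ih => intro Δ ρ hρ; exact .lam (ih (up _ hρ))
  | app _ _ ih1 ih2 => intro Δ ρ hρ; exact .app (ih1 hρ) (ih2 hρ)
  | pair _ _ ih1 ih2 => intro Δ ρ hρ; exact .pair (ih1 hρ) (ih2 hρ)
  | fst _ ih => intro Δ ρ hρ; exact .fst (ih hρ)
  | snd _ ih => intro Δ ρ hρ; exact .snd (ih hρ)
  | ret m _ ih => intro Δ ρ hρ; exact .ret m (ih hρ)
  | iota _ ih => intro Δ ρ hρ; exact .iota (ih hρ)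
  | bind _ _ ih1 ih2 => intro Δ ρ hρ; exact .bind (ih1 hρ) (ih2 (up _ hρ))
  | conv hΓ hA _ ih =>
    intro Δ ρ hρ
    refine .conv (CtxEq.refl _) hA (ih ?_)
    intro n B hn
    obtain ⟨B', h1, h2⟩ := hΓ.lookup hn
    obtain ⟨B'', h3, h4⟩ := hρ _ _ h1
    exact ⟨B'', h3, h4.trans h2.symm⟩

theorem HasType.wk {Γ : Ctx Sg.Ground} {M A} (h : HasType Sg Γ M A) (B : Ty Sg.Ground) :
    HasType Sg (B :: Γ) M.wk A :=
  h.ren fun _ C hn => ⟨C, hn, .refl C⟩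

theorem HasType.sub {Γ : Ctx Sg.Ground} {M A} (h : HasType Sg Γ M A) :
    ∀ {Δ : Ctx Sg.Ground} {σ : ℕ → Tm Sg.Ground Sg.Const},
      (∀ n B, Γ[n]? = some B → HasType Sg Δ (σ n) B) → HasType Sg Δ (M.sub σ) A := by
  have up : ∀ {Γ Δ : Ctx Sg.Ground} {σ : ℕ → Tm Sg.Ground Sg.Const} (A : Ty Sg.Ground),
      (∀ n B, Γ[n]? = some B → HasType Sg Δ (σ n) B) →
      ∀ n B, (A :: Γ)[n]? = some B → HasType Sg (A :: Δ) (Tm.up σ n) B := by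
    intro Γ Δ σ A hσ n B hn
    cases n with
    | zero => exact .var hn
    | succ n => exact (hσ n B hn).wk A
  induction h with
  | var h => intro Δ σ hσ; exact hσ _ _ h
  | const Γ c => intro Δ σ _; exact .const _ _
  | star Γ => intro Δ σ _; exact .star _
  | lam _ ih => intro Δ σ hσ; exact .lam (ih (up _ hσ))
  | app _ _ ih1 ih2 => intro Δ σ hσ; exact .app (ih1 hσ) (ih2 hσ)
  | pair _ _ ih1 ih2 => intro Δ σ hσ; exact .pair (ih1 hσ) (ih2 hσ)
  | fst _ ih => intro Δ σ hσ; exact .fst (ih hσ)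
  | snd _ ih => intro Δ σ hσ; exact .snd (ih hσ)
  | ret m _ ih => intro Δ σ hσ; exact .ret m (ih hσ)
  | iota _ ih => intro Δ σ hσ; exact .iota (ih hσ)
  | bind _ _ ih1 ih2 => intro Δ σ hσ; exact .bind (ih1 hσ) (ih2 (up _ hσ))
  | conv hΓ hA _ ih =>
    intro Δ σ hσ
    refine .conv (CtxEq.refl _) hA (ih ?_)
    intro n B hn
    obtain ⟨B', h1, h2⟩ := hΓ.lookup hn
    exact .conv (CtxEq.refl _) h2.symm (hσ _ _ h1)

/-- Substitution of one-variable terms is well typed. -/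
theorem HasType.replace {A B B' C : Ty Sg.Ground} {M N} (hM : HasType Sg [A] M B)
    (hB : TyEq Sg B B') (hN : HasType Sg [B'] N C) : HasType Sg [A] (N.replace M) C := by
  refine hN.sub ?_
  intro n D hn
  cases n with
  | zero =>
    simp only [List.getElem?_cons_zero, Option.some.injEq] at hn
    subst hn
    exact .conv (CtxEq.refl _) hB hM
  | succ n => simp at hn

end Typing

/-- Substitution of one-variable terms respects provable equality. -/
theorem TmEq.replace {Th : Theory.{u, v}} {A B C : Th.Types} {M M' N N' : Th.Terms}
    (hM : Th.HasType [A] M B) (hM' : Th.HasType [A] M' B)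
    (hN : Th.HasType [B] N C) (hN' : Th.HasType [B] N' C)
    (eM : Th.TmEq [A] M M' B) (eN : Th.TmEq [B] N N' C) :
    Th.TmEq [A] (N.replace M) (N'.replace M') C := by
  have look : ∀ (n : ℕ) (D : Th.Types), [B][n]? = some D →
      [B, A][upRen Nat.succ n]? = some D := by
    intro n D hn
    cases n with
    | zero => exact hn
    | succ n => simp at hn
  have wN : Th.HasType [B, A] (N.ren (upRen Nat.succ)) C :=
    hN.ren fun n D hn => ⟨D, look n D hn, .refl D⟩
  have wN' : Th.HasType [B, A] (N'.ren (upRen Nat.succ)) C :=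
    hN'.ren fun n D hn => ⟨D, look n D hn, .refl D⟩
  rw [← Tm.inst_ren_upRen N M, ← Tm.inst_ren_upRen N' M']
  exact (TmEq.lam_beta wN hM).symm.trans
    ((TmEq.app_eq (TmEq.lam_eq (TmEq.ren _ look eN)) eM).trans (TmEq.lam_beta wN' hM'))

/-! ## The syntactic category -/

/-- Type equality as an equivalence relation on types. -/
def tySetoid (Th : Theory.{u, v}) : Setoid Th.Types where
  r := Th.TyEq
  iseqv := ⟨.refl, .symm, .trans⟩

/-- Objects of the syntactic category: types modulo type equality. -/
def SynCat (Th : Theory.{u, v}) : Type u := Quotient (tySetoid Th)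

/-- The object `[A]`. -/
def SynCat.of {Th : Theory.{u, v}} (A : Th.Types) : SynCat Th := Quotient.mk (tySetoid Th) A

theorem SynCat.of_eq_iff {Th : Theory.{u, v}} {A B : Th.Types} :
    SynCat.of A = SynCat.of B ↔ Th.TyEq A B :=
  ⟨fun h => Quotient.exact h, fun h => Quotient.sound h⟩

/-- Judgements `x : A ⊢ M : B` with `[A] = X` and `[B] = Y`. -/
structure Judgement {Th : Theory.{u, v}} (X Y : SynCat Th) where
  dom : Th.Types
  tm : Th.Terms
  cod : Th.Types
  typed : Th.HasType [dom] tm cod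
  dom_eq : SynCat.of dom = X
  cod_eq : SynCat.of cod = Y

/-- Judgements `x : A ⊢ f : B` and `x : A' ⊢ f' : B'` with `A = A'` and `B = B'` are identified
if `x : A ⊢ f = f' : B`. -/
def judgementSetoid {Th : Theory.{u, v}} (X Y : SynCat Th) : Setoid (Judgement X Y) where
  r j k := Th.TmEq [j.dom] j.tm k.tm j.cod
  iseqv := by
    have conv : ∀ {j k : Judgement X Y} {M N : Th.Terms},
        Th.TmEq [j.dom] M N j.cod → Th.TmEq [k.dom] M N k.cod := fun {j k _ _} h =>
      .conv (.cons (SynCat.of_eq_iff.1 (j.dom_eq.trans k.dom_eq.symm)) .nil)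
        (SynCat.of_eq_iff.1 (j.cod_eq.trans k.cod_eq.symm)) h
    exact ⟨fun j => .refl j.typed, fun {j k} h => conv (j := j) (k := k) (.symm h),
      fun {j k _} h h' => .trans h (conv (j := k) (k := j) h')⟩

/-- Morphisms of the syntactic category. -/
def SynHom {Th : Theory.{u, v}} (X Y : SynCat Th) : Type (max u v) :=
  Quotient (judgementSetoid X Y)

/-- `[y : B ⊢ g : C] ∘ [x : A ⊢ f : B'] = [x : A ⊢ g[f/y] : C]` on judgements. -/
def Judgement.comp {Th : Theory.{u, v}} {X Y Z : SynCat Th} (f : Judgement X Y)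
    (g : Judgement Y Z) : Judgement X Z where
  dom := f.dom
  tm := g.tm.replace f.tm
  cod := g.cod
  typed := f.typed.replace (SynCat.of_eq_iff.1 (f.cod_eq.trans g.dom_eq.symm)) g.typed
  dom_eq := f.dom_eq
  cod_eq := g.cod_eq

theorem Judgement.comp_congr {Th : Theory.{u, v}} {X Y Z : SynCat Th} {f f' : Judgement X Y}
    {g g' : Judgement Y Z} (hf : (judgementSetoid X Y).r f f')
    (hg : (judgementSetoid Y Z).r g g') :
    (judgementSetoid X Z).r (f.comp g) (f'.comp g') := by
  have hB : Th.TyEq f.cod g.dom := SynCat.of_eq_iff.1 (f.cod_eq.trans g.dom_eq.symm)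
  have hA : Th.TyEq f'.dom f.dom := SynCat.of_eq_iff.1 (f'.dom_eq.trans f.dom_eq.symm)
  have hB' : Th.TyEq f'.cod g.dom := SynCat.of_eq_iff.1 (f'.cod_eq.trans g.dom_eq.symm)
  have hg' : Th.TyEq g'.dom g.dom := SynCat.of_eq_iff.1 (g'.dom_eq.trans g.dom_eq.symm)
  have hC : Th.TyEq g'.cod g.cod := SynCat.of_eq_iff.1 (g'.cod_eq.trans g.cod_eq.symm)
  exact TmEq.replace (.conv (CtxEq.refl _) hB f.typed)
    (.conv (.cons hA .nil) hB' f'.typed) g.typed (.conv (.cons hg' .nil) hC g'.typed)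
    (.conv (CtxEq.refl _) hB hf) hg

/-- The judgement `x : A ⊢ x : A`, where `A` is a representative of `X`. -/
noncomputable def Judgement.id {Th : Theory.{u, v}} (X : SynCat Th) : Judgement X X where
  dom := Quotient.out X
  tm := .var 0
  cod := Quotient.out X
  typed := .var rfl
  dom_eq := Quotient.out_eq X
  cod_eq := Quotient.out_eq X

/-- The syntactic category of a theory. -/
noncomputable instance (Th : Theory.{u, v}) : Category.{max u v} (SynCat Th) where
  Hom X Y := SynHom X Y
  id X := Quotient.mk _ (Judgement.id X)
  comp {X Y Z} f g := Quotient.map₂ (sa := judgementSetoid X Y) (sb := judgementSetoid Y Z)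
    (sc := judgementSetoid X Z) Judgement.comp
    (fun _ _ hf _ _ hg => Judgement.comp_congr hf hg) f g
  id_comp {X Y} f := by
    refine Quotient.inductionOn f fun j => Quotient.sound ?_
    change Th.TmEq [Quotient.out X] (j.tm.replace (.var 0)) j.tm j.cod
    rw [Tm.replace_var]
    have h : Th.TyEq j.dom (Quotient.out X) :=
      SynCat.of_eq_iff.1 (j.dom_eq.trans (Quotient.out_eq X).symm)
    exact .refl (.conv (.cons h .nil) (.refl _) j.typed)
  comp_id {X Y} f := by
    refine Quotient.inductionOn f fun j => Quotient.sound ?_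
    have h : Th.TyEq j.cod (Quotient.out Y) :=
      SynCat.of_eq_iff.1 (j.cod_eq.trans (Quotient.out_eq Y).symm)
    exact .refl (.conv (CtxEq.refl _) h j.typed)
  assoc {W X Y Z} f g h := by
    refine Quotient.inductionOn₃ f g h fun j k l => Quotient.sound ?_
    change Th.TmEq [j.dom] (l.tm.replace (k.tm.replace j.tm))
      ((l.tm.replace k.tm).replace j.tm) l.cod
    rw [Tm.replace_replace]
    exact .refl ((j.comp k).comp l).typed

/-- `Rep f A M B` says that `f = [x : A ⊢ M : B]`; in particular `x : A ⊢ M : B` is derivable and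
`f` is a morphism from `[A]` to `[B]`. -/
def Rep {Th : Theory.{u, v}} {X Y : SynCat Th} (f : X ⟶ Y) (A : Th.Types) (M : Th.Terms)
    (B : Th.Types) : Prop :=
  ∃ (h : Th.HasType [A] M B) (hX : SynCat.of A = X) (hY : SynCat.of B = Y),
    f = Quotient.mk (judgementSetoid X Y) ⟨A, M, B, h, hX, hY⟩

/-! ## Models -/

section Models

variable {C : Type u} [Category.{v} C] [CartesianMonoidalCategory C]

/-- The symmetry of the cartesian product. -/
def symm (X Y : C) : X ⊗ Y ⟶ Y ⊗ X := lift (snd X Y) (fst X Y)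

/-- A strong monad for the cartesian monoidal structure. -/
structure StrongMonad (C : Type u) [Category.{v} C] [CartesianMonoidalCategory C]
    extends Monad C where
  /-- The (left) strength. -/
  τ : ∀ X Y : C, X ⊗ toMonad.obj Y ⟶ toMonad.obj (X ⊗ Y)
  τ_naturality : ∀ {X X' Y Y' : C} (f : X ⟶ X') (g : Y ⟶ Y'),
    (f ⊗ₘ toMonad.map g) ≫ τ X' Y' = τ X Y ≫ toMonad.map (f ⊗ₘ g)
  τ_leftUnitor : ∀ X : C, τ (𝟙_ C) X ≫ toMonad.map (λ_ X).hom = (λ_ (toMonad.obj X)).hom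
  τ_associator : ∀ X Y Z : C, τ (X ⊗ Y) Z ≫ toMonad.map (α_ X Y Z).hom =
    (α_ X Y (toMonad.obj Z)).hom ≫ X ◁ τ Y Z ≫ τ X (Y ⊗ Z)
  τ_η : ∀ X Y : C, X ◁ toMonad.η.app Y ≫ τ X Y = toMonad.η.app (X ⊗ Y)
  τ_μ : ∀ X Y : C, X ◁ toMonad.μ.app Y ≫ τ X Y =
    τ X (toMonad.obj Y) ≫ toMonad.map (τ X Y) ≫ toMonad.μ.app (X ⊗ Y)

/-- The right strength. -/
def StrongMonad.τ' (T : StrongMonad C) (X Y : C) : T.obj X ⊗ Y ⟶ T.obj (X ⊗ Y) :=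
  symm (T.obj X) Y ≫ T.τ Y X ≫ T.map (symm Y X)

/-- A morphism of strong monads. -/
structure StrongMonadHom (S T : StrongMonad C) extends MonadHom S.toMonad T.toMonad where
  app_τ : ∀ X Y : C, S.τ X Y ≫ app (X ⊗ Y) = X ◁ app Y ≫ T.τ X Y

/-- `ι` is a monomorphism in the category of strong monads on `C`, i.e. `S` is a strong submonad
of `T` via `ι`. -/
def StrongMonadHom.IsMono {S T : StrongMonad C} (ι : StrongMonadHom S T) : Prop :=
  ∀ (P : StrongMonad C) (a b : StrongMonadHom P S),
    (∀ X, a.app X ≫ ι.app X = b.app X ≫ ι.app X) → ∀ X, a.app X = b.app X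

/-- `(Z, f)` is a central cone of `T` at `X`. -/
def IsCentralCone (T : StrongMonad C) {Z X : C} (f : Z ⟶ T.obj X) : Prop :=
  ∀ Y : C,
    f ▷ T.obj Y ≫ T.τ (T.obj X) Y ≫ T.map (T.τ' X Y) ≫ T.μ.app (X ⊗ Y) =
    f ▷ T.obj Y ≫ T.τ' X (T.obj Y) ≫ T.map (T.τ X Y) ≫ T.μ.app (X ⊗ Y)

/-- The rest of a CSC-model on the cartesian closed category `C`: a strong monad `T` and a
central submonad `S` of `T` via `ι`. -/
structure CSCModel (C : Type u) [Category.{v} C] [CartesianMonoidalCategory C]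
    [MonoidalClosed C] where
  T : StrongMonad C
  S : StrongMonad C
  ι : StrongMonadHom S T
  mono : ι.IsMono
  central : ∀ X : C, IsCentralCone T (ι.app X)

/-- The strong monad of the model for each modality. -/
def CSCModel.mon [MonoidalClosed C] (𝓜 : CSCModel C) : Mode → StrongMonad C
  | .S => 𝓜.S
  | .T => 𝓜.T

/-- Interpretation of types, given the interpretation of ground types. -/
def CSCModel.ty [MonoidalClosed C] (𝓜 : CSCModel C) {G : Type w} (g : G → C) : Ty G → C
  | .ground a => g a
  | .one => 𝟙_ C
  | .arrow A B => (ihom (𝓜.ty g A)).obj (𝓜.ty g B)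
  | .prod A B => 𝓜.ty g A ⊗ 𝓜.ty g B
  | .mon m A => (𝓜.mon m).obj (𝓜.ty g A)

/-- Interpretation of contexts. -/
def CSCModel.ctx [MonoidalClosed C] (𝓜 : CSCModel C) {G : Type w} (g : G → C) : Ctx G → C
  | [] => 𝟙_ C
  | A :: Γ => 𝓜.ctx g Γ ⊗ 𝓜.ty g A

end Models

/-! ## Interpretations -/

/-- An interpretation of the theory `Th` in a CSC-model: objects for the ground types and a
morphism `⟦Γ⟧ ⟶ ⟦A⟧` for each well-formed term `Γ ⊢ M : A`, which follow the structure of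
terms. -/
structure Interpretation (Th : Theory.{u, v}) {C : Type w} [Category.{t} C]
    [CartesianMonoidalCategory C] [MonoidalClosed C] (𝓜 : CSCModel C) where
  ground : Th.Ground → C
  tm : ∀ {Γ : Th.Ctxs} {M : Th.Terms} {A : Th.Types}, Th.HasType Γ M A →
    (𝓜.ctx ground Γ ⟶ 𝓜.ty ground A)
  conv : ∀ {Γ Δ M A B} (_ : Th.CtxEq Γ Δ) (_ : Th.TyEq A B)
    (h : Th.HasType Γ M A) (h' : Th.HasType Δ M B)
    (eΓ : 𝓜.ctx ground Δ = 𝓜.ctx ground Γ) (eA : 𝓜.ty ground A = 𝓜.ty ground B),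
    tm h' = eqToHom eΓ ≫ tm h ≫ eqToHom eA
  var_zero : ∀ {Γ A} (h : Th.HasType (A :: Γ) (.var 0) A), tm h = snd _ _
  var_succ : ∀ {Γ A B n} (h : Th.HasType Γ (.var n) A)
    (h' : Th.HasType (B :: Γ) (.var (n + 1)) A), tm h' = fst _ _ ≫ tm h
  const : ∀ {Γ c} (h : Th.HasType [] (.const c) (Th.constTy c))
    (h' : Th.HasType Γ (.const c) (Th.constTy c)),
    tm h' = toUnit (𝓜.ctx ground Γ) ≫ tm h
  star : ∀ {Γ} (h : Th.HasType Γ .star .one), tm h = toUnit _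
  lam : ∀ {Γ A B M} (h : Th.HasType (A :: Γ) M B)
    (h' : Th.HasType Γ (.lam A M) (.arrow A B)),
    tm h' = MonoidalClosed.curry (symm (𝓜.ty ground A) (𝓜.ctx ground Γ) ≫ tm h)
  app : ∀ {Γ A B M N} (hM : Th.HasType Γ M (.arrow A B)) (hN : Th.HasType Γ N A)
    (h : Th.HasType Γ (.app M N) B),
    tm h = lift (tm hN) (tm hM) ≫ (ihom.ev (𝓜.ty ground A)).app (𝓜.ty ground B)
  pair : ∀ {Γ A B M N} (hM : Th.HasType Γ M A) (hN : Th.HasType Γ N B)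
    (h : Th.HasType Γ (.pair M N) (.prod A B)), tm h = lift (tm hM) (tm hN)
  fst : ∀ {Γ A B M} (hM : Th.HasType Γ M (.prod A B)) (h : Th.HasType Γ (.fst M) A),
    tm h = tm hM ≫ fst (𝓜.ty ground A) (𝓜.ty ground B)
  snd : ∀ {Γ A B M} (hM : Th.HasType Γ M (.prod A B)) (h : Th.HasType Γ (.snd M) B),
    tm h = tm hM ≫ snd (𝓜.ty ground A) (𝓜.ty ground B)
  ret : ∀ {m Γ A M} (hM : Th.HasType Γ M A) (h : Th.HasType Γ (.ret m M) (.mon m A)),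
    tm h = tm hM ≫ (𝓜.mon m).η.app (𝓜.ty ground A)
  iota : ∀ {Γ A M} (hM : Th.HasType Γ M (.mon .S A)) (h : Th.HasType Γ (.iota M) (.mon .T A)),
    tm h = tm hM ≫ 𝓜.ι.app (𝓜.ty ground A)
  bind : ∀ {m Γ A B M N} (hM : Th.HasType Γ M (.mon m A))
    (hN : Th.HasType (A :: Γ) N (.mon m B)) (h : Th.HasType Γ (.bind m M N) (.mon m B)),
    tm h = lift (𝟙 (𝓜.ctx ground Γ)) (tm hM) ≫
      (𝓜.mon m).τ (𝓜.ctx ground Γ) (𝓜.ty ground A) ≫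
      (𝓜.mon m).map (tm hN) ≫ (𝓜.mon m).μ.app (𝓜.ty ground B)

namespace Interpretation

variable {Th : Theory.{u, v}} {C : Type w} [Category.{t} C]
  [CartesianMonoidalCategory C] [MonoidalClosed C] {𝓜 : CSCModel C}

/-- The object `⟦A⟧`. -/
def ty (I : Interpretation Th 𝓜) (A : Th.Types) : C := 𝓜.ty I.ground A

/-- Soundness of an interpretation. -/
def Sound (I : Interpretation Th 𝓜) : Prop :=
  (∀ A B : Th.Types, Th.TyEq A B → I.ty A = I.ty B) ∧
  ∀ (Γ : Th.Ctxs) (M N : Th.Terms) (A : Th.Types), Th.TmEq Γ M N A →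
    ∀ (hM : Th.HasType Γ M A) (hN : Th.HasType Γ N A), I.tm hM = I.tm hN

/-- Completeness of an interpretation. -/
def Complete (I : Interpretation Th 𝓜) : Prop :=
  (∀ A B : Th.Types, Th.TyEq A B ↔ I.ty A = I.ty B) ∧
  ∀ (Γ : Th.Ctxs) (M N : Th.Terms) (A : Th.Types) (hM : Th.HasType Γ M A)
    (hN : Th.HasType Γ N A), Th.TmEq Γ M N A ↔ I.tm hM = I.tm hN

end Interpretation

/-! ## The syntactic model -/

section Syntactic

variable {Th : Theory.{u, v}}

/-- The chosen cartesian closed structure of the syntactic category is the one given by the type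
constructors `1`, `×` and `→`. -/
structure IsSyntacticCCC (Th : Theory.{u, v}) [CartesianMonoidalCategory (SynCat Th)]
    [MonoidalClosed (SynCat Th)] : Prop where
  unit : 𝟙_ (SynCat Th) = SynCat.of .one
  tensor : ∀ A B : Th.Types, SynCat.of A ⊗ SynCat.of B = SynCat.of (.prod A B)
  fst : ∀ A B : Th.Types,
    Rep (fst (SynCat.of A) (SynCat.of B)) (.prod A B) (.fst (.var 0)) A
  snd : ∀ A B : Th.Types,
    Rep (snd (SynCat.of A) (SynCat.of B)) (.prod A B) (.snd (.var 0)) B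
  exp : ∀ A B : Th.Types, (ihom (SynCat.of A)).obj (SynCat.of B) = SynCat.of (.arrow A B)
  ev : ∀ A B : Th.Types, Rep ((ihom.ev (SynCat.of A)).app (SynCat.of B))
    (.prod A (.arrow A B)) (.app (.snd (.var 0)) (.fst (.var 0))) B

variable [CartesianMonoidalCategory (SynCat Th)] [MonoidalClosed (SynCat Th)]

/-- The strong monad `X` on the syntactic category is the syntactic one for the modality `m`. -/
structure StrongMonad.IsSyntactic (m : Mode) (X : StrongMonad (SynCat Th)) : Prop where
  obj : ∀ A : Th.Types, X.obj (SynCat.of A) = SynCat.of (.mon m A)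
  map : ∀ {A B : Th.Types} {M : Th.Terms} (f : SynCat.of A ⟶ SynCat.of B), Rep f A M B →
    Rep (X.map f) (.mon m A) (.bind m (.var 0) (.ret m M)) (.mon m B)
  unit : ∀ A : Th.Types, Rep (X.η.app (SynCat.of A)) A (.ret m (.var 0)) (.mon m A)
  mult : ∀ A : Th.Types, Rep (X.μ.app (SynCat.of A)) (.mon m (.mon m A))
    (.bind m (.var 0) (.var 0)) (.mon m A)
  strength : ∀ A B : Th.Types, Rep (X.τ (SynCat.of A) (SynCat.of B)) (.prod A (.mon m B))
    (.bind m (.snd (.var 0)) (.ret m (.pair (.fst (.var 1)) (.var 0)))) (.mon m (.prod A B))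

/-- The model on the syntactic category is `(S(Th), T, S, ι)`. -/
structure CSCModel.IsSyntactic (𝓜 : CSCModel (SynCat Th)) : Prop where
  ccc : IsSyntacticCCC Th
  T : 𝓜.T.IsSyntactic .T
  S : 𝓜.S.IsSyntactic .S
  ι : ∀ A : Th.Types, Rep (𝓜.ι.app (SynCat.of A)) (.mon .S A) (.iota (.var 0)) (.mon .T A)

/-- An interpretation of `Th` in its syntactic category is canonical if ground types are
interpreted by themselves, and constants `c` by `[x : 1 ⊢ c : A]`. -/
structure Interpretation.IsCanonical {𝓜 : CSCModel (SynCat Th)} (I : Interpretation Th 𝓜) :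
    Prop where
  ground : ∀ g : Th.Ground, I.ground g = SynCat.of (.ground g)
  const : ∀ (c : Th.Const) (h : Th.HasType [] (.const c) (Th.constTy c)),
    Rep (I.tm h) .one (.const c) (Th.constTy c)

end Syntactic

end CSC

namespace CSC

/-! ## Substitution and provable equality -/

section Substitution

variable {Sg : Signature.{u, v}}

/-! This is a term model, so completeness is built in: Hom-sets are quotients by provable equality,
and two terms denote the same morphism exactly when they are provably equal as terms in one
variable. Two things need work: that the quotient is a CSC-model, and that an arbitrary context can
be traded for a single variable.

For the second, a context `Γ` is packed into the product type `ctxTy Γ`, and `Γ ⊢ M : A` is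
interpreted by the class of `M` with its variables replaced by projections (`envSub`). Substituting
the tuple of variables undoes this up to β, so `tmEq_env_iff` gives soundness and completeness
together. The interpretation is read off the term, not built by recursion on typing derivations, so
coherence is no issue; the structural clauses are checked afterwards.

For the first, equations between morphisms become equations between terms through `Rep`. Products
and exponentials are the βη-laws. A strong monad is obtained from a unit and a `bind` in context
that satisfies the three monad laws and is stable under substitution (`BindMonad`). Map,
multiplication and strength are `do`-expressions, and their axioms follow by normalising. For the
term model each law is one rule of the calculus up to β for projections. A central submonad is
handled likewise (`CentralBind`), with centrality as an exchange of two binds.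

Underneath lies the metatheory of substitution: typing of both sides of an equation (`TmEq.typed`),
stability under simultaneous substitution (`TmEq.sub`) and congruence in the substituted terms
(`HasType.sub_congr`). Uniqueness is an induction on typing derivations, since every clause of an
interpretation determines its value. -/

theorem HasType.sub_agree {Γ : Ctx Sg.Ground} {M A} (h : HasType Sg Γ M A) :
    ∀ {σ τ : ℕ → Tm Sg.Ground Sg.Const}, (∀ n < Γ.length, σ n = τ n) → M.sub σ = M.sub τ := by
  have up : ∀ {k : ℕ} {σ τ : ℕ → Tm Sg.Ground Sg.Const}, (∀ n < k, σ n = τ n) →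
      ∀ n < k + 1, Tm.up σ n = Tm.up τ n := by
    intro k σ τ H n hn
    cases n with
    | zero => rfl
    | succ n => simp only [Tm.up, H n (by omega)]
  induction h with
  | var h =>
    intro σ τ H
    exact H _ (List.getElem?_eq_some_iff.1 h).1
  | const | star => intros; rfl
  | lam _ ih => intro σ τ H; simp only [Tm.sub, ih (up H)]
  | app _ _ ih1 ih2 => intro σ τ H; simp only [Tm.sub, ih1 H, ih2 H]
  | pair _ _ ih1 ih2 => intro σ τ H; simp only [Tm.sub, ih1 H, ih2 H]
  | fst _ ih => intro σ τ H; simp only [Tm.sub, ih H]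
  | snd _ ih => intro σ τ H; simp only [Tm.sub, ih H]
  | ret m _ ih => intro σ τ H; simp only [Tm.sub, ih H]
  | iota _ ih => intro σ τ H; simp only [Tm.sub, ih H]
  | bind _ _ ih1 ih2 => intro σ τ H; simp only [Tm.sub, ih1 H, ih2 (up H)]
  | conv hΓ _ _ ih =>
    intro σ τ H
    exact ih fun n hn => H n (List.Forall₂.length_eq hΓ ▸ hn)

theorem HasType.inst {Γ : Ctx Sg.Ground} {M N A B} (hN : HasType Sg (A :: Γ) N B)
    (hM : HasType Sg Γ M A) : HasType Sg Γ (N.inst M) B := by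
  refine hN.sub ?_
  intro n D hn
  cases n with
  | zero =>
    simp only [List.getElem?_cons_zero, Option.some.injEq] at hn
    exact hn ▸ hM
  | succ n => exact .var hn

theorem Tm.ren_eq_sub {G : Type u} {K : Type v} (ρ : ℕ → ℕ) (M : Tm G K) :
    M.ren ρ = M.sub (fun n => .var (ρ n)) := by
  rw [← Tm.sub_var (M.ren ρ), Tm.sub_ren]
  rfl

end Substitution

/-! ### Metatheory of provable equality -/

section TmEq

variable {Th : Theory.{u, v}}

/-- Every rule carries enough typing premises to recover both sides; for axioms these are `ax_left`
and `ax_right`. Later lemmas can then omit typing hypotheses. -/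
theorem TmEq.typed {Γ : Th.Ctxs} {M N : Th.Terms} {A : Th.Types} (h : Th.TmEq Γ M N A) :
    Th.HasType Γ M A ∧ Th.HasType Γ N A := by
  have renHyp : ∀ {Γ Δ : Th.Ctxs} {ρ : ℕ → ℕ},
      (∀ (n : ℕ) (B : Th.Types), Γ[n]? = some B → Δ[ρ n]? = some B) →
      ∀ n B, Γ[n]? = some B → ∃ B', Δ[ρ n]? = some B' ∧ Th.TyEq B' B :=
    fun hρ n B hn => ⟨B, hρ n B hn, .refl B⟩
  have skip : ∀ {Γ : Th.Ctxs} {A B : Th.Types} {P C}, Th.HasType (B :: Γ) P C →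
      Th.HasType (B :: A :: Γ) (P.ren (upRen Nat.succ)) C := fun hP =>
    hP.ren fun n D hn => ⟨D, by cases n <;> exact hn, .refl D⟩
  have swap : ∀ {Γ : Th.Ctxs} {A B : Th.Types} {P C}, Th.HasType (B :: A :: Γ) P C →
      Th.HasType (A :: B :: Γ) (P.ren swapRen) C := fun hP =>
    hP.ren fun n D hn => ⟨D, by rcases n with _ | _ | n <;> exact hn, .refl D⟩
  induction h with
  | ax h => exact ⟨Th.ax_left h, Th.ax_right h⟩
  | conv hΓ hA _ ih => exact ⟨.conv hΓ hA ih.1, .conv hΓ hA ih.2⟩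
  | refl h => exact ⟨h, h⟩
  | symm _ ih => exact ih.symm
  | trans _ _ ih1 ih2 => exact ⟨ih1.1, ih2.2⟩
  | ren ρ hρ _ ih => exact ⟨ih.1.ren (renHyp hρ), ih.2.ren (renHyp hρ)⟩
  | subst hM _ ih => exact ⟨ih.1.inst hM, ih.2.inst hM⟩
  | one_eta Γ => exact ⟨.star _, .var rfl⟩
  | pair_eq _ _ ih1 ih2 => exact ⟨.pair ih1.1 ih2.1, .pair ih1.2 ih2.2⟩
  | fst_beta hM hN => exact ⟨.fst (.pair hM hN), hM⟩
  | snd_beta hM hN => exact ⟨.snd (.pair hM hN), hN⟩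
  | prod_eta hM => exact ⟨.pair (.fst hM) (.snd hM), hM⟩
  | app_eq _ _ ih1 ih2 => exact ⟨.app ih1.1 ih2.1, .app ih1.2 ih2.2⟩
  | lam_eq _ ih => exact ⟨.lam ih.1, .lam ih.2⟩
  | lam_beta hM hN => exact ⟨.app (.lam hM) hN, hM.inst hN⟩
  | lam_eta hM => exact ⟨.lam (.app (hM.wk _) (.var rfl)), hM⟩
  | ret_eq m _ ih => exact ⟨.ret m ih.1, .ret m ih.2⟩
  | bind_eq _ _ ih1 ih2 => exact ⟨.bind ih1.1 ih2.1, .bind ih1.2 ih2.2⟩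
  | bind_beta hM hN => exact ⟨.bind (.ret _ hM) hN, hN.inst hM⟩
  | bind_eta hM => exact ⟨.bind hM (.ret _ (.var rfl)), hM⟩
  | bind_assoc hM hN hP => exact ⟨.bind (.bind hM hN) hP, .bind hM (.bind hN (skip hP))⟩
  | central hM hN hP =>
    exact ⟨.bind (.iota hM) (.bind (hN.wk _) hP), .bind hN (.bind (.iota (hM.wk _)) (swap hP))⟩
  | iota_eq _ ih => exact ⟨.iota ih.1, .iota ih.2⟩
  | iota_mono hM hN => exact ⟨hM, hN⟩
  | iota_comp hM hN => exact ⟨.bind (.iota hM) (.iota hN), .iota (.bind hM hN)⟩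
  | iota_ret hM => exact ⟨.iota (.ret _ hM), .ret _ hM⟩

/-- Provable equality is stable under simultaneous substitution. -/
theorem TmEq.sub {Γ : Th.Ctxs} : ∀ {Δ : Th.Ctxs} {M N : Th.Terms} {A : Th.Types}
    {σ : ℕ → Th.Terms}, Th.TmEq Γ M N A → (∀ n B, Γ[n]? = some B → Th.HasType Δ (σ n) B) →
    Th.TmEq Δ (M.sub σ) (N.sub σ) A := by
  induction Γ with
  | nil =>
    -- A closed equation moves to `Δ` by a renaming, and its terms do not see which substitution is
    -- applied.
    intro Δ M N A σ h _
    have h' : Th.TmEq Δ (M.ren id) (N.ren id) A := .ren id (by simp) h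
    rw [Tm.ren_id, Tm.ren_id, ← Tm.sub_var M, ← Tm.sub_var N,
      h.typed.1.sub_agree (τ := σ) (by simp), h.typed.2.sub_agree (τ := σ) (by simp)] at h'
    exact h'
  | cons B Γ ih =>
    intro Δ M N A σ h hσ
    have hs : ∀ n C, Γ[n]? = some C → Th.HasType Δ (σ (n + 1)) C := fun n C hn => hσ (n + 1) C hn
    have e : ∀ P : Th.Terms, (P.sub (Tm.up fun n => σ (n + 1))).inst (σ 0) = P.sub σ := by
      intro P
      rw [Tm.inst, Tm.sub_sub]
      congr 1
      funext n
      cases n with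
      | zero => rfl
      | succ n => simp only [Tm.up, Tm.wk, Tm.sub_ren]; exact Tm.sub_var _
    -- The head variable is abstracted, so that the shorter context suffices; applying both sides to
    -- `σ 0` and β-reducing restores it.
    have h0 := ih (TmEq.lam_eq h) hs
    have typed : ∀ {P : Th.Terms}, Th.HasType (B :: Γ) P A →
        Th.HasType (B :: Δ) (P.sub (Tm.up fun n => σ (n + 1))) A := by
      intro P hP
      refine hP.sub ?_
      intro n C hn
      cases n with
      | zero => exact .var hn
      | succ n => exact (hs n C hn).wk B
    have h0' := hσ 0 B rfl
    have b1 := TmEq.lam_beta (typed h.typed.1) h0'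
    have b2 := TmEq.lam_beta (typed h.typed.2) h0'
    rw [e] at b1 b2
    exact b1.symm.trans ((TmEq.app_eq h0 (.refl h0')).trans b2)

theorem TmEq.wk {Γ : Th.Ctxs} {M N : Th.Terms} {A : Th.Types} (h : Th.TmEq Γ M N A)
    (B : Th.Types) : Th.TmEq (B :: Γ) M.wk N.wk A :=
  .ren _ (fun _ _ hn => hn) h

/-- Congruence of projections is not among the rules. It follows by applying the function `λp. π₁ p`
to both sides and β-reducing. -/
theorem TmEq.fst_congr {Γ : Th.Ctxs} {M N : Th.Terms} {A B : Th.Types}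
    (h : Th.TmEq Γ M N (.prod A B)) : Th.TmEq Γ (.fst M) (.fst N) A := by
  have hl : Th.HasType (.prod A B :: Γ) (.fst (.var 0)) A := .fst (.var rfl)
  exact (TmEq.lam_beta hl h.typed.1).symm.trans
    ((TmEq.app_eq (.refl (.lam hl)) h).trans (.lam_beta hl h.typed.2))

theorem TmEq.snd_congr {Γ : Th.Ctxs} {M N : Th.Terms} {A B : Th.Types}
    (h : Th.TmEq Γ M N (.prod A B)) : Th.TmEq Γ (.snd M) (.snd N) B := by
  have hl : Th.HasType (.prod A B :: Γ) (.snd (.var 0)) B := .snd (.var rfl)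
  exact (TmEq.lam_beta hl h.typed.1).symm.trans
    ((TmEq.app_eq (.refl (.lam hl)) h).trans (.lam_beta hl h.typed.2))

theorem TmEq.star_eta {Γ : Th.Ctxs} {M : Th.Terms} (h : Th.HasType Γ M .one) :
    Th.TmEq Γ .star M .one :=
  .subst h (.one_eta Γ)

/-- Substituting provably equal terms gives provably equal terms. -/
theorem HasType.sub_congr {Γ : Th.Ctxs} {M : Th.Terms} {A : Th.Types} (h : Th.HasType Γ M A) :
    ∀ {Δ : Th.Ctxs} {σ τ : ℕ → Th.Terms},
      (∀ n B, Γ[n]? = some B → Th.TmEq Δ (σ n) (τ n) B) →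
      Th.TmEq Δ (M.sub σ) (M.sub τ) A := by
  have up : ∀ {Γ Δ : Th.Ctxs} {σ τ : ℕ → Th.Terms} (A : Th.Types),
      (∀ n B, Γ[n]? = some B → Th.TmEq Δ (σ n) (τ n) B) →
      ∀ n B, (A :: Γ)[n]? = some B → Th.TmEq (A :: Δ) (Tm.up σ n) (Tm.up τ n) B := by
    intro Γ Δ σ τ A hσ n B hn
    cases n with
    | zero => exact .refl (.var hn)
    | succ n => exact (hσ n B hn).wk A
  induction h with
  | var h => intro Δ σ τ H; exact H _ _ h
  | const Γ c => intros; exact .refl (.const _ _)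
  | star Γ => intros; exact .refl (.star _)
  | lam _ ih => intro Δ σ τ H; exact .lam_eq (ih (up _ H))
  | app _ _ ih1 ih2 => intro Δ σ τ H; exact .app_eq (ih1 H) (ih2 H)
  | pair _ _ ih1 ih2 => intro Δ σ τ H; exact .pair_eq (ih1 H) (ih2 H)
  | fst _ ih =>
    intro Δ σ τ H
    exact .fst_congr (ih H)
  | snd _ ih =>
    intro Δ σ τ H
    exact .snd_congr (ih H)
  | ret m _ ih => intro Δ σ τ H; exact .ret_eq m (ih H)
  | iota _ ih => intro Δ σ τ H; exact .iota_eq (ih H)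
  | bind _ _ ih1 ih2 => intro Δ σ τ H; exact .bind_eq (ih1 H) (ih2 (up _ H))
  | conv hΓ hA _ ih =>
    intro Δ σ τ H
    refine .conv (CtxEq.refl _) hA (ih fun n B hn => ?_)
    obtain ⟨B', h1, h2⟩ := hΓ.lookup hn
    exact .conv (CtxEq.refl _) h2.symm (H _ _ h1)

/-- The type annotation of an abstraction may be changed along type equality. -/
theorem TmEq.lam_ty {Γ : Th.Ctxs} {M : Th.Terms} {A A' B : Th.Types} (hA : Th.TyEq A A')
    (h : Th.HasType (A :: Γ) M B) : Th.TmEq Γ (.lam A M) (.lam A' M) (.arrow A B) := by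
  -- The abstraction also has type `A' → B`, so it can be η-expanded with annotation `A'`; a β-step
  -- under the new binder then removes the old annotation.
  have hL : Th.HasType Γ (.lam A M) (.arrow A' B) :=
    .conv (CtxEq.refl _) (.arrow hA (.refl _)) (.lam h)
  have hM : Th.HasType (A :: A' :: Γ) (M.ren (upRen Nat.succ)) B :=
    h.ren fun n D hn => ⟨D, by cases n <;> exact hn, .refl D⟩
  have b := TmEq.lam_beta (Γ := A' :: Γ) (N := .var 0) hM (.conv (CtxEq.refl _) hA.symm (.var rfl))
  rw [Tm.inst_ren_upRen, Tm.replace_var] at b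
  exact .conv (CtxEq.refl _) (.arrow hA.symm (.refl _))
    ((TmEq.lam_eta hL).symm.trans (.lam_eq b))

/-- Change of representatives of the types of a one-variable equation. -/
theorem TmEq.convTy {A A' B B' : Th.Types} {M N : Th.Terms} (hA : Th.TyEq A A')
    (hB : Th.TyEq B B') (h : Th.TmEq [A] M N B) : Th.TmEq [A'] M N B' :=
  .conv (.cons hA .nil) hB h

theorem HasType.convTy {A A' B B' : Th.Types} {M : Th.Terms} (hA : Th.TyEq A A')
    (hB : Th.TyEq B B') (h : Th.HasType [A] M B) : Th.HasType [A'] M B' :=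
  .conv (.cons hA .nil) hB h

/-- A one-variable equation may be instantiated in any context. -/
theorem TmEq.sub_one {Γ : Th.Ctxs} {A B : Th.Types} {M N : Th.Terms} {σ τ : ℕ → Th.Terms}
    (h : Th.TmEq [A] M N B) (h0 : Th.TmEq Γ (σ 0) (τ 0) A) :
    Th.TmEq Γ (M.sub σ) (N.sub τ) B := by
  -- First the equation is instantiated at `σ`, then `σ` is exchanged for `τ` in its right-hand
  -- side.
  refine (h.sub ?_).trans (h.typed.2.sub_congr ?_) <;>
  · intro n C hn
    cases n with
    | zero =>
      simp only [List.getElem?_cons_zero, Option.some.injEq] at hn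
      subst hn
      first | exact h0.typed.1 | exact h0
    | succ n => simp at hn

/-- A term over a one-entry context sees only `σ 0`. This lemma and `sub_one_wk` absorb the
substitutions left over after β-steps. -/
theorem TmEq.sub_one_self {A B : Th.Types} {M : Th.Terms} {σ : ℕ → Th.Terms}
    (h : Th.HasType [A] M B) (h0 : Th.TmEq [A] (σ 0) (.var 0) A) : Th.TmEq [A] (M.sub σ) M B := by
  have := TmEq.sub_one (σ := σ) (τ := .var) (.refl h) h0
  rwa [Tm.sub_var] at this

theorem TmEq.sub_one_wk {Γ : Th.Ctxs} {A B C : Th.Types} {M : Th.Terms} {σ : ℕ → Th.Terms}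
    (h : Th.HasType [A] M B) (h0 : Th.TmEq (C :: A :: Γ) (σ 0) (.var 1) A) :
    Th.TmEq (C :: A :: Γ) (M.sub σ) M.wk B := by
  rw [Tm.wk, Tm.ren_eq_sub]
  exact TmEq.sub_one (.refl h) h0

theorem HasType.sub_one {Γ : Th.Ctxs} {A B : Th.Types} {M : Th.Terms} {σ : ℕ → Th.Terms}
    (h : Th.HasType [A] M B) (h0 : Th.HasType Γ (σ 0) A) : Th.HasType Γ (M.sub σ) B :=
  (TmEq.sub_one (.refl h) (.refl h0)).typed.1

end TmEq

/-! ## Representatives of morphisms -/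

namespace Rep

variable {Th : Theory.{u, v}} {X Y Z : SynCat Th} {f g : X ⟶ Y} {A A' B B' C : Th.Types}
  {M N : Th.Terms}

theorem typed (h : Rep f A M B) : Th.HasType [A] M B := h.choose

theorem dom_eq (h : Rep f A M B) : SynCat.of A = X := h.choose_spec.choose

theorem cod_eq (h : Rep f A M B) : SynCat.of B = Y := h.choose_spec.choose_spec.choose

theorem of_eq (hf : Rep f A M B) (hg : Rep g A' N B') (h : Th.TmEq [A] M N B) : f = g := by
  obtain ⟨_, _, _, rfl⟩ := hf
  obtain ⟨_, _, _, rfl⟩ := hg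
  exact Quotient.sound (s := judgementSetoid X Y) h

/-- Quotients by an equivalence relation are effective; the completeness direction for terms comes
from here. -/
theorem tmEq (hf : Rep f A M B) (hg : Rep f A' N B') : Th.TmEq [A] M N B := by
  obtain ⟨_, _, _, e⟩ := hf
  obtain ⟨_, _, _, e'⟩ := hg
  exact Quotient.exact (s := judgementSetoid X Y) (e.symm.trans e')

theorem mk (h : Th.HasType [A] M B) (hA : SynCat.of A = X) (hB : SynCat.of B = Y) :
    Rep (Quotient.mk (judgementSetoid X Y) ⟨A, M, B, h, hA, hB⟩ : X ⟶ Y) A M B :=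
  ⟨h, hA, hB, rfl⟩

theorem congr (hf : Rep f A M B) (h : Th.TmEq [A] M N B) : Rep f A N B := by
  obtain ⟨_, hA, hB, rfl⟩ := hf
  exact ⟨h.typed.2, hA, hB, Quotient.sound (s := judgementSetoid X Y) h⟩

theorem conv (hf : Rep f A M B) (hA : SynCat.of A' = X) (hB : SynCat.of B' = Y) :
    Rep f A' M B' := by
  obtain ⟨h, hA', hB', rfl⟩ := hf
  have eA := SynCat.of_eq_iff.1 (hA'.trans hA.symm)
  have eB := SynCat.of_eq_iff.1 (hB'.trans hB.symm)
  exact ⟨h.convTy eA eB, hA, hB, Quotient.sound (s := judgementSetoid X Y) (.refl h)⟩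

/-- The types can be prescribed because conversion moves a judgement between equal types; composable
morphisms thus get terms that match on the nose. -/
theorem exists_tm (f : X ⟶ Y) (hA : SynCat.of A = X) (hB : SynCat.of B = Y) :
    ∃ M, Rep f A M B := by
  obtain ⟨j, rfl⟩ := Quotient.exists_rep f
  exact ⟨j.tm, (mk j.typed j.dom_eq j.cod_eq).conv hA hB⟩

theorem id (A : Th.Types) (hA : SynCat.of A = X) : Rep (𝟙 X) A (.var 0) A :=
  conv (mk (.var rfl) (Quotient.out_eq X) (Quotient.out_eq X)) hA hA

theorem comp {f : X ⟶ Y} {g : Y ⟶ Z} (hf : Rep f A M B) (hg : Rep g B N C) :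
    Rep (f ≫ g) A (N.replace M) C := by
  obtain ⟨hM, hA, hB, rfl⟩ := hf
  obtain ⟨hN, _, hC, rfl⟩ := hg
  exact ⟨hM.replace (.refl _) hN, hA, hC, rfl⟩

theorem eqToHom (h : X = Y) (A : Th.Types) (hA : SynCat.of A = X) :
    Rep (CategoryTheory.eqToHom h) A (.var 0) A := by
  subst h
  exact id A hA

end Rep

/-! ## Exponentials and strong monads in cartesian categories -/

section Cartesian

variable {C : Type u} [Category.{v} C] [CartesianMonoidalCategory C]

/-- Exponentials for a cartesian monoidal category, by universal property. -/
structure Exponentials (C : Type u) [Category.{v} C] [CartesianMonoidalCategory C] where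
  exp : C → C → C
  ev : ∀ X Y : C, X ⊗ exp X Y ⟶ Y
  curry : ∀ {X Y Z : C}, (X ⊗ Z ⟶ Y) → (Z ⟶ exp X Y)
  curry_ev : ∀ {X Y Z : C} (f : X ⊗ Z ⟶ Y), X ◁ curry f ≫ ev X Y = f
  curry_uniq : ∀ {X Y Z : C} (g : Z ⟶ exp X Y), curry (X ◁ g ≫ ev X Y) = g

namespace Exponentials

variable (E : Exponentials C)

/-- Currying as a bijection. -/
def homEquiv (X Z Y : C) : ((tensorLeft X).obj Z ⟶ Y) ≃ (Z ⟶ E.exp X Y) where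
  toFun f := E.curry f
  invFun g := X ◁ g ≫ E.ev X Y
  left_inv f := E.curry_ev f
  right_inv g := E.curry_uniq g

theorem homEquiv_naturality (X Z' Z Y : C) (f : Z' ⟶ Z) (g : (tensorLeft X).obj Z ⟶ Y) :
    E.homEquiv X Z' Y ((tensorLeft X).map f ≫ g) = f ≫ E.homEquiv X Z Y g := by
  rw [← Equiv.eq_symm_apply]
  change X ◁ f ≫ g = X ◁ (f ≫ E.curry g) ≫ E.ev X Y
  rw [MonoidalCategory.whiskerLeft_comp, Category.assoc, E.curry_ev]

/-- The closed structure given by exponentials. -/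
@[reducible]
def monoidalClosed : MonoidalClosed C where
  closed X :=
    { rightAdj := Adjunction.rightAdjointOfEquiv (E.homEquiv X) (E.homEquiv_naturality X)
      adj := Adjunction.adjunctionOfEquivRight (E.homEquiv X) (E.homEquiv_naturality X) }

/-- The counit of an adjunction built from a hom-bijection is the inverse bijection at the identity.
-/
theorem ev_app (X Y : C) :
    letI := E.monoidalClosed
    (ihom.ev X).app Y = E.ev X Y := by
  change (E.homEquiv X _ _).symm (𝟙 _) = _
  change X ◁ 𝟙 _ ≫ E.ev X Y = _
  rw [MonoidalCategory.whiskerLeft_id, Category.id_comp]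

theorem curry_eq (X Y Z : C) (f : X ⊗ Z ⟶ Y) :
    letI := E.monoidalClosed
    MonoidalClosed.curry f = E.curry f := by
  let _ := E.monoidalClosed
  refine ((MonoidalClosed.eq_curry_iff f (E.curry f)).2 ?_).symm
  exact (congrArg (X ◁ E.curry f ≫ ·) (E.ev_app X Y)).trans (E.curry_ev f)

end Exponentials

/-- A strong monad presented by its unit and the interpretation `bind M N` of
`do x ← M; N` in context. -/
structure BindMonad (C : Type u) [Category.{v} C] [CartesianMonoidalCategory C] where
  obj : C → C
  η : ∀ X : C, X ⟶ obj X
  bind : ∀ {G X Y : C}, (G ⟶ obj X) → (G ⊗ X ⟶ obj Y) → (G ⟶ obj Y)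
  comp_bind : ∀ {H G X Y : C} (F : H ⟶ G) (M : G ⟶ obj X) (N : G ⊗ X ⟶ obj Y),
    F ≫ bind M N = bind (F ≫ M) (lift (fst H X ≫ F) (snd H X) ≫ N)
  bind_beta : ∀ {G X Y : C} (M : G ⟶ X) (N : G ⊗ X ⟶ obj Y),
    bind (M ≫ η X) N = lift (𝟙 G) M ≫ N
  bind_eta : ∀ {G X : C} (M : G ⟶ obj X), bind M (snd G X ≫ η X) = M
  bind_assoc : ∀ {G X Y Z : C} (M : G ⟶ obj X) (N : G ⊗ X ⟶ obj Y) (P : G ⊗ Y ⟶ obj Z),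
    bind (bind M N) P =
      bind M (bind N (lift (fst (G ⊗ X) Y ≫ fst G X) (snd (G ⊗ X) Y) ≫ P))

/-! ### From `bind` in context to a strong monad -/

namespace BindMonad

variable (T : BindMonad C)

/-- `ret M`, in context. -/
def ret {G X : C} (M : G ⟶ X) : G ⟶ T.obj X := M ≫ T.η X

/-- Units are expressed by `ret`, which reassociation of composites cannot break up. With the laws
for `bind` and `ret`, `simp` then brings both sides of a monad axiom to nested binds. -/
theorem η_eq_ret (X : C) : T.η X = T.ret (𝟙 X) := by simp [ret]

theorem comp_ret {H G X : C} (F : H ⟶ G) (M : G ⟶ X) : F ≫ T.ret M = T.ret (F ≫ M) := by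
  simp [ret]

theorem ret_bind {G X Y : C} (M : G ⟶ X) (N : G ⊗ X ⟶ T.obj Y) :
    T.bind (T.ret M) N = lift (𝟙 G) M ≫ N := T.bind_beta M N

theorem bind_ret {G X : C} (M : G ⟶ T.obj X) : T.bind M (T.ret (snd G X)) = M := T.bind_eta M

/-- Functorial action. -/
def map {X Y : C} (f : X ⟶ Y) : T.obj X ⟶ T.obj Y := T.bind (𝟙 _) (T.ret (snd _ _ ≫ f))

/-- Multiplication. -/
def mult (X : C) : T.obj (T.obj X) ⟶ T.obj X := T.bind (𝟙 _) (snd _ _)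

/-- Strength. -/
def strength (X Y : C) : X ⊗ T.obj Y ⟶ T.obj (X ⊗ Y) :=
  T.bind (snd _ _) (T.ret (lift (fst _ _ ≫ fst _ _) (snd _ _)))

theorem comp_map {G X Y : C} (M : G ⟶ T.obj X) (f : X ⟶ Y) :
    M ≫ T.map f = T.bind M (T.ret (snd _ _ ≫ f)) := by
  simp [map, comp_bind, comp_ret]

theorem comp_mult {G X : C} (M : G ⟶ T.obj (T.obj X)) : M ≫ T.mult X = T.bind M (snd _ _) := by
  simp [mult, comp_bind]

theorem comp_strength {G X Y : C} (M : G ⟶ X ⊗ T.obj Y) :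
    M ≫ T.strength X Y =
      T.bind (M ≫ snd _ _) (T.ret (lift (fst _ _ ≫ M ≫ fst _ _) (snd _ _))) := by
  simp [strength, comp_bind, comp_ret]

/-- The strong monad presented by `bind`. -/
def toStrongMonad : StrongMonad C where
  obj := T.obj
  map f := T.map f
  map_id X := by simp [map, bind_ret]
  map_comp f g := by simp [map, comp_bind, comp_ret, bind_assoc, ret_bind]
  η := { app := T.η, naturality := fun X Y f => by simp [η_eq_ret, comp_ret, comp_map, ret_bind] }
  μ := { app := T.mult, naturality := fun X Y f => by
          simp [map, mult, ret_bind, bind_assoc, comp_bind, comp_ret] }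
  assoc X := by
    simp [map, mult, ret_bind, bind_assoc, comp_bind, comp_ret]
  left_unit X := by simp [η_eq_ret, comp_mult, ret_bind]
  right_unit X := by
    simp [η_eq_ret, comp_mult, ret_bind, map, bind_assoc, comp_ret, bind_ret]
  τ := T.strength
  τ_naturality f g := by
    simp [strength, comp_map, ret_bind, bind_assoc, comp_ret, comp_bind]
  τ_leftUnitor X := by
    simp [strength, comp_map, bind_assoc, comp_ret, ret_bind, leftUnitor_hom, bind_ret]
  τ_associator X Y Z := by
    -- Here `a` need not be a literal pairing; surjective pairing splits it so that the associator
    -- can be computed.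
    have e : ∀ {G : C} (a : G ⟶ X ⊗ Y) (b : G ⟶ Z),
        lift a b ≫ (α_ X Y Z).hom = lift (a ≫ fst _ _) (lift (a ≫ snd _ _) b) := by
      intro G a b
      rw [← lift_lift_associator_hom, lift_comp_fst_snd]
    simp [strength, comp_map, ret_bind, bind_assoc, comp_ret, comp_bind, e]
  τ_η X Y := by simp [η_eq_ret, comp_strength, ret_bind, comp_ret]
  τ_μ X Y := by
    simp [strength, mult, comp_map, ret_bind, bind_assoc, comp_ret, comp_bind]

/-- The categorical interpretation of `do`. -/
theorem bind_eq {G X Y : C} (M : G ⟶ T.obj X) (N : G ⊗ X ⟶ T.obj Y) :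
    lift (𝟙 G) M ≫ T.toStrongMonad.τ G X ≫ T.toStrongMonad.map N ≫ T.toStrongMonad.μ.app Y =
      T.bind M N := by
  change lift (𝟙 G) M ≫ T.strength G X ≫ T.map N ≫ T.mult Y = T.bind M N
  -- The strength pairs the environment with the value of `M`, the map runs `N` on the pair without
  -- joining, and the multiplication joins; associativity collapses the result.
  rw [← Category.assoc, comp_strength, ← Category.assoc, comp_map, comp_mult]
  simp [bind_assoc, comp_ret, ret_bind]

/-- Right strength. -/
def strength' (X Y : C) : T.obj X ⊗ Y ⟶ T.obj (X ⊗ Y) :=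
  T.bind (fst _ _) (T.ret (lift (snd _ _) (fst _ _ ≫ snd _ _)))

theorem toStrongMonad_τ' (X Y : C) : T.toStrongMonad.τ' X Y = T.strength' X Y := by
  change symm _ _ ≫ T.strength Y X ≫ T.map (symm Y X) = _
  simp [symm, strength, strength', comp_bind, comp_map, bind_assoc, comp_ret, ret_bind]

/-- This composite runs the effect of the second factor first, while `strength'_strength` runs that
of the first factor first. Centrality compares the two orders. -/
theorem strength_strength' (X Y : C) :
    T.strength (T.obj X) Y ≫ T.map (T.strength' X Y) ≫ T.mult (X ⊗ Y) =
      T.bind (snd _ _) (T.bind (fst _ _ ≫ fst _ _)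
        (T.ret (lift (snd _ _) (fst _ _ ≫ snd _ _)))) := by
  simp [strength, strength', map, mult, comp_bind, bind_assoc, comp_ret,
    ret_bind]

theorem strength'_strength (X Y : C) :
    T.strength' X (T.obj Y) ≫ T.map (T.strength X Y) ≫ T.mult (X ⊗ Y) =
      T.bind (fst _ _) (T.bind (fst _ _ ≫ snd _ _)
        (T.ret (lift (fst _ _ ≫ snd _ _) (snd _ _)))) := by
  simp [strength, strength', map, mult, comp_bind, bind_assoc, comp_ret,
    ret_bind]

end BindMonad

/-- A central submonad, in terms of `bind`. -/
structure CentralBind (S T : BindMonad C) where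
  ι : ∀ X : C, S.obj X ⟶ T.obj X
  mono : ∀ X : C, Mono (ι X)
  η_ι : ∀ X : C, S.η X ≫ ι X = T.η X
  bind_ι : ∀ {G X Y : C} (M : G ⟶ S.obj X) (N : G ⊗ X ⟶ S.obj Y),
    T.bind (M ≫ ι X) (N ≫ ι Y) = S.bind M N ≫ ι Y
  central : ∀ {G X Y Z : C} (M : G ⟶ S.obj X) (N : G ⟶ T.obj Y) (P : (G ⊗ X) ⊗ Y ⟶ T.obj Z),
    T.bind (M ≫ ι X) (T.bind (fst _ _ ≫ N) P) =
      T.bind N (T.bind (fst _ _ ≫ M ≫ ι X)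
        (lift (lift (fst _ _ ≫ fst _ _) (snd _ _)) (fst _ _ ≫ snd _ _) ≫ P))

/-! ### From exchange of binds to a central submonad -/

namespace CentralBind

variable {S T : BindMonad C} (κ : CentralBind S T)

theorem ret_ι {G X : C} (M : G ⟶ X) : S.ret M ≫ κ.ι X = T.ret M := by
  simp only [BindMonad.ret, Category.assoc, κ.η_ι]

/-- The morphism of strong monads. -/
def toHom : StrongMonadHom S.toStrongMonad T.toStrongMonad where
  app := κ.ι
  naturality X Y f := by
    -- Since `ι` commutes with `ret` and `bind`, it commutes with every operation defined from them;
    -- the other fields use the same argument.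
    change S.map f ≫ κ.ι Y = κ.ι X ≫ T.map f
    rw [T.comp_map, BindMonad.map, ← κ.bind_ι, κ.ret_ι, Category.id_comp]
  app_η := κ.η_ι
  app_μ X := by
    change S.mult X ≫ κ.ι X = (S.map (κ.ι X) ≫ κ.ι (T.obj X)) ≫ T.mult X
    rw [T.comp_mult, BindMonad.mult, BindMonad.map, ← κ.bind_ι, ← κ.bind_ι, κ.ret_ι]
    simp [T.bind_assoc, T.ret_bind]
  app_τ X Y := by
    change S.strength X Y ≫ κ.ι _ = X ◁ κ.ι Y ≫ T.strength X Y
    rw [T.comp_strength, BindMonad.strength, ← κ.bind_ι, κ.ret_ι]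
    simp

/-- This is `κ.central` in the generic context `S X × T Y`: the two computations are the two
projections, and the continuation returns the pair of results. -/
theorem isCentralCone (X : C) : IsCentralCone T.toStrongMonad (κ.ι X) := by
  intro Y
  rw [T.toStrongMonad_τ', T.toStrongMonad_τ']
  change κ.ι X ▷ T.obj Y ≫ T.strength (T.obj X) Y ≫ T.map (T.strength' X Y) ≫ T.mult (X ⊗ Y) =
    κ.ι X ▷ T.obj Y ≫ T.strength' X (T.obj Y) ≫ T.map (T.strength X Y) ≫ T.mult (X ⊗ Y)
  have h := κ.central (fst (S.obj X) (T.obj Y)) (snd _ _)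
    (T.ret (lift (fst _ _ ≫ snd _ _) (snd _ _)))
  simp only [T.comp_ret, comp_lift, lift_fst_assoc, lift_snd] at h
  simp [T.strength_strength', T.strength'_strength, T.comp_ret, T.comp_bind, h]

/-- The model presented by a central submonad. -/
def toModel [MonoidalClosed C] : CSCModel C where
  T := T.toStrongMonad
  S := S.toStrongMonad
  ι := κ.toHom
  mono P a b h X := by
    have := κ.mono X
    exact (cancel_mono (κ.ι X)).1 (h X)
  central := κ.isCentralCone

end CentralBind
end Cartesian
/-! ## The cartesian closed structure of the syntactic category -/

section Syntactic

variable {Th : Theory.{u, v}}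

/-! ### Finite products in the syntactic category -/

namespace SynCat

/-- `[A] × [B] = [A × B]`. -/
def prod (X Y : SynCat Th) : SynCat Th :=
  Quotient.map₂ (sa := tySetoid Th) (sb := tySetoid Th) (sc := tySetoid Th) Ty.prod
    (fun _ _ h _ _ h' => TyEq.prod h h') X Y

/-- The exponential `[A → B]`. -/
def arrow (X Y : SynCat Th) : SynCat Th :=
  Quotient.map₂ (sa := tySetoid Th) (sb := tySetoid Th) (sc := tySetoid Th) Ty.arrow
    (fun _ _ h _ _ h' => TyEq.arrow h h') X Y

/-- `m [A] = [m A]`. -/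
def mon (m : Mode) (X : SynCat Th) : SynCat Th :=
  Quotient.map (sa := tySetoid Th) (sb := tySetoid Th) (Ty.mon m)
    (fun _ _ h => TyEq.mon m h) X

theorem of_prod {A B : Th.Types} {X Y : SynCat Th} (hA : of A = X) (hB : of B = Y) :
    of (.prod A B) = prod X Y := by subst hA hB; rfl

theorem of_arrow {A B : Th.Types} {X Y : SynCat Th} (hA : of A = X) (hB : of B = Y) :
    of (.arrow A B) = arrow X Y := by subst hA hB; rfl

theorem of_mon (m : Mode) {A : Th.Types} {X : SynCat Th} (hA : of A = X) :
    of (.mon m A) = mon m X := by subst hA; rfl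

/-- A type that represents the object `X`. -/
noncomputable def out (X : SynCat Th) : Th.Types := Quotient.out X

theorem of_out (X : SynCat Th) : of X.out = X := Quotient.out_eq X

/-- First projection. -/
noncomputable def fstHom (X Y : SynCat Th) : prod X Y ⟶ X :=
  Quotient.mk (judgementSetoid _ _)
    ⟨.prod X.out Y.out, .fst (.var 0), X.out, .fst (.var rfl), of_prod X.of_out Y.of_out, X.of_out⟩

/-- Second projection. -/
noncomputable def sndHom (X Y : SynCat Th) : prod X Y ⟶ Y :=
  Quotient.mk (judgementSetoid _ _)
    ⟨.prod X.out Y.out, .snd (.var 0), Y.out, .snd (.var rfl), of_prod X.of_out Y.of_out, Y.of_out⟩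

theorem rep_fstHom {X Y : SynCat Th} {A B : Th.Types} (hA : of A = X) (hB : of B = Y) :
    Rep (fstHom X Y) (.prod A B) (.fst (.var 0)) A :=
  (Rep.mk _ _ _).conv (of_prod hA hB) hA

theorem rep_sndHom {X Y : SynCat Th} {A B : Th.Types} (hA : of A = X) (hB : of B = Y) :
    Rep (sndHom X Y) (.prod A B) (.snd (.var 0)) B :=
  (Rep.mk _ _ _).conv (of_prod hA hB) hB

/-- The morphism is built from chosen representatives, but the property quantifies over all of them,
so later arguments never mention the choice. -/
theorem exists_pair {X Y Z : SynCat Th} (f : Z ⟶ X) (g : Z ⟶ Y) :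
    ∃ h : Z ⟶ prod X Y, ∀ {A B C M N}, Rep f C M A → Rep g C N B →
      Rep h C (.pair M N) (.prod A B) := by
  obtain ⟨M, hM⟩ := Rep.exists_tm f Z.of_out X.of_out
  obtain ⟨N, hN⟩ := Rep.exists_tm g Z.of_out Y.of_out
  refine ⟨_, fun {A B C M' N'} hf hg =>
    ((Rep.mk (.pair hM.typed hN.typed) Z.of_out (of_prod X.of_out Y.of_out)).congr ?_).conv
      hf.dom_eq (of_prod hf.cod_eq hg.cod_eq)⟩
  exact .pair_eq (hM.tmEq hf) (hN.tmEq hg)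

/-- Pairing. -/
noncomputable def pairHom {X Y Z : SynCat Th} (f : Z ⟶ X) (g : Z ⟶ Y) : Z ⟶ prod X Y :=
  (exists_pair f g).choose

theorem rep_pairHom {X Y Z : SynCat Th} {f : Z ⟶ X} {g : Z ⟶ Y} {A B C : Th.Types}
    {M N : Th.Terms} (hf : Rep f C M A) (hg : Rep g C N B) :
    Rep (pairHom f g) C (.pair M N) (.prod A B) :=
  (exists_pair f g).choose_spec hf hg

theorem pairHom_fstHom {X Y Z : SynCat Th} (f : Z ⟶ X) (g : Z ⟶ Y) :
    pairHom f g ≫ fstHom X Y = f := by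
  obtain ⟨M, hM⟩ := Rep.exists_tm f Z.of_out X.of_out
  obtain ⟨N, hN⟩ := Rep.exists_tm g Z.of_out Y.of_out
  exact ((rep_pairHom hM hN).comp (rep_fstHom X.of_out Y.of_out)).of_eq hM
    (.fst_beta hM.typed hN.typed)

theorem pairHom_sndHom {X Y Z : SynCat Th} (f : Z ⟶ X) (g : Z ⟶ Y) :
    pairHom f g ≫ sndHom X Y = g := by
  obtain ⟨M, hM⟩ := Rep.exists_tm f Z.of_out X.of_out
  obtain ⟨N, hN⟩ := Rep.exists_tm g Z.of_out Y.of_out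
  exact ((rep_pairHom hM hN).comp (rep_sndHom X.of_out Y.of_out)).of_eq hN
    (.snd_beta hM.typed hN.typed)

theorem pairHom_eta {X Y Z : SynCat Th} (h : Z ⟶ prod X Y) :
    pairHom (h ≫ fstHom X Y) (h ≫ sndHom X Y) = h := by
  obtain ⟨M, hM⟩ := Rep.exists_tm h Z.of_out (of_prod X.of_out Y.of_out)
  exact (rep_pairHom (hM.comp (rep_fstHom X.of_out Y.of_out))
    (hM.comp (rep_sndHom X.of_out Y.of_out))).of_eq hM (.prod_eta hM.typed)

/-- Products in the syntactic category. -/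
noncomputable def prodLimit (X Y : SynCat Th) : Limits.LimitCone (Limits.pair X Y) where
  cone := Limits.BinaryFan.mk (fstHom X Y) (sndHom X Y)
  isLimit := Limits.BinaryFan.IsLimit.mk _ (fun f g => pairHom f g) pairHom_fstHom
    pairHom_sndHom (by
      rintro Z f g h rfl rfl
      exact (pairHom_eta h).symm)

/-- The terminal object `[1]`. -/
noncomputable def oneLimit : Limits.LimitCone (Functor.empty.{0} (SynCat Th)) where
  cone := Limits.asEmptyCone (of .one)
  isLimit := Limits.IsTerminal.ofUniqueHom
    (fun X => Quotient.mk (judgementSetoid _ _) ⟨X.out, .star, .one, .star _, X.of_out, rfl⟩)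
    (fun X f => by
      obtain ⟨M, hM⟩ := Rep.exists_tm f X.of_out (rfl : of .one = _)
      exact hM.of_eq (Rep.mk _ _ _) (TmEq.star_eta hM.typed).symm)

/-- With these chosen limits, unit, tensor and projections are definitionally the syntactic ones. -/
noncomputable instance : CartesianMonoidalCategory (SynCat Th) :=
  .ofChosenFiniteProducts oneLimit prodLimit

end SynCat

open SynCat

namespace Rep

variable {W X Y Z : SynCat Th} {A B C : Th.Types} {M N : Th.Terms}

theorem fst (hA : of A = X) (hB : of B = Y) :
    Rep (fst X Y) (.prod A B) (.fst (.var 0)) A := rep_fstHom hA hB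

theorem snd (hA : of A = X) (hB : of B = Y) :
    Rep (snd X Y) (.prod A B) (.snd (.var 0)) B := rep_sndHom hA hB

theorem lift {f : Z ⟶ X} {g : Z ⟶ Y} (hf : Rep f C M A) (hg : Rep g C N B) :
    Rep (lift f g) C (.pair M N) (.prod A B) := by
  have e : CartesianMonoidalCategory.lift f g = pairHom f g :=
    CartesianMonoidalCategory.hom_ext _ _ ((lift_fst f g).trans (pairHom_fstHom f g).symm)
      ((lift_snd f g).trans (pairHom_sndHom f g).symm)
  rw [e]
  exact rep_pairHom hf hg

theorem toUnit (hA : of A = X) : Rep (toUnit X) A .star .one := by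
  obtain ⟨M, hM⟩ := Rep.exists_tm (SemiCartesianMonoidalCategory.toUnit X) hA
    (rfl : of .one = 𝟙_ (SynCat Th))
  exact hM.congr (TmEq.star_eta hM.typed).symm

theorem whiskerLeft {g : Y ⟶ Z} (hC : of C = X) (hg : Rep g A M B) :
    Rep (X ◁ g) (.prod C A) (.pair (.fst (.var 0)) (M.replace (.snd (.var 0)))) (.prod C B) := by
  have e : X ◁ g = CartesianMonoidalCategory.lift (CartesianMonoidalCategory.fst X Y)
      (CartesianMonoidalCategory.snd X Y ≫ g) := by ext <;> simp
  rw [e]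
  exact (fst hC hg.dom_eq).lift ((snd hC hg.dom_eq).comp hg)

end Rep

/-! ### Exponentials in the syntactic category -/

namespace SynCat

/-- The bound variable `0` is the argument and variable `1` the parameter, with the argument as left
factor. Independence of representatives needs `TmEq.lam_ty`, because the abstraction records a type.
-/
theorem exists_curry {X Y Z : SynCat Th} (f : X ⊗ Z ⟶ Y) :
    ∃ h : Z ⟶ arrow X Y, ∀ {A B C M}, of A = X → of C = Z → Rep f (.prod A C) M B →
      Rep h C (.lam A (M.replace (.pair (.var 0) (.var 1)))) (.arrow A B) := by
  obtain ⟨M, hM⟩ := Rep.exists_tm f (of_prod X.of_out Z.of_out) Y.of_out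
  have hp : Th.HasType [X.out, Z.out] (.pair (.var 0) (.var 1)) (.prod X.out Z.out) :=
    .pair (.var rfl) (.var rfl)
  have hl : Th.HasType [Z.out] (.lam X.out (M.replace (.pair (.var 0) (.var 1))))
      (.arrow X.out Y.out) := .lam (hM.typed.sub_one hp)
  refine ⟨_, fun {A B C M'} hA hC hf =>
    ((Rep.mk hl Z.of_out (of_arrow X.of_out Y.of_out)).conv hC
      (of_arrow hA hf.cod_eq)).congr ?_⟩
  have eA : Th.TyEq X.out A := of_eq_iff.1 (X.of_out.trans hA.symm)
  have eB : Th.TyEq Y.out B := of_eq_iff.1 (Y.of_out.trans hf.cod_eq.symm)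
  have eC : Th.TyEq Z.out C := of_eq_iff.1 (Z.of_out.trans hC.symm)
  refine TmEq.convTy eC (.arrow eA eB) ((TmEq.lam_ty eA (hM.typed.sub_one hp)).trans ?_)
  exact .conv (CtxEq.refl _) (.arrow eA.symm (.refl _)) (.lam_eq
    (.conv (.cons eA (CtxEq.refl _)) (.refl _) (TmEq.sub_one (hM.tmEq hf) (.refl hp))))

/-- Currying. -/
noncomputable def curryHom {X Y Z : SynCat Th} (f : X ⊗ Z ⟶ Y) : Z ⟶ arrow X Y :=
  (exists_curry f).choose

theorem rep_curryHom {X Y Z : SynCat Th} {f : X ⊗ Z ⟶ Y} {A B C : Th.Types} {M : Th.Terms}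
    (hA : of A = X) (hC : of C = Z) (hf : Rep f (.prod A C) M B) :
    Rep (curryHom f) C (.lam A (M.replace (.pair (.var 0) (.var 1)))) (.arrow A B) :=
  (exists_curry f).choose_spec hA hC hf

/-- Evaluation. -/
noncomputable def evHom (X Y : SynCat Th) : X ⊗ arrow X Y ⟶ Y :=
  Quotient.mk (judgementSetoid _ _)
    ⟨.prod X.out (.arrow X.out Y.out), .app (.snd (.var 0)) (.fst (.var 0)), Y.out,
      .app (.snd (.var rfl)) (.fst (.var rfl)),
      of_prod X.of_out (of_arrow X.of_out Y.of_out), Y.of_out⟩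

theorem rep_evHom {X Y : SynCat Th} {A B : Th.Types} (hA : of A = X) (hB : of B = Y) :
    Rep (evHom X Y) (.prod A (.arrow A B)) (.app (.snd (.var 0)) (.fst (.var 0))) B :=
  (Rep.mk _ _ _).conv (of_prod hA (of_arrow hA hB)) hB

/-- Exponentials of the syntactic category. -/
noncomputable def exponentials (Th : Theory.{u, v}) : Exponentials (SynCat Th) where
  exp := arrow
  ev := evHom
  curry := curryHom
  curry_ev {X Y Z} f := by
    obtain ⟨M, hM⟩ := Rep.exists_tm f (of_prod X.of_out Z.of_out) Y.of_out
    have hp : Th.HasType [X.out, Z.out] (.pair (.var 0) (.var 1)) (.prod X.out Z.out) :=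
      .pair (.var rfl) (.var rfl)
    have hv : Th.HasType [.prod X.out Z.out] (.var 0) (.prod X.out Z.out) := .var rfl
    have hc := rep_curryHom X.of_out Z.of_out hM
    refine ((hc.whiskerLeft X.of_out).comp (rep_evHom X.of_out Y.of_out)).of_eq hM ?_
    have hC := hc.typed.sub_one (Γ := [.prod X.out Z.out])
      (σ := Tm.headSub (.snd (.var 0))) (.snd hv)
    refine (TmEq.app_eq (.snd_beta (.fst hv) hC) (.fst_beta (.fst hv) hC)).trans ?_
    have hM' : Th.HasType [X.out, .prod X.out Z.out]
        ((M.replace (.pair (.var 0) (.var 1))).sub (Tm.up (Tm.headSub (.snd (.var 0))))) Y.out := by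
      rw [Tm.replace, Tm.sub_sub]
      exact hM.typed.sub_one (HasType.pair (.var rfl) (.snd (.var rfl)))
    refine (TmEq.lam_beta hM' (.fst hv)).trans ?_
    rw [Tm.replace, Tm.inst, Tm.sub_sub, Tm.sub_sub]
    -- What remains is `M` at `⟨π₁ p, π₂ p⟩`, which surjective pairing turns into `M` at `p`.
    exact .sub_one_self hM.typed (.prod_eta hv)
  curry_uniq {X Y Z} g := by
    obtain ⟨M, hM⟩ := Rep.exists_tm g Z.of_out (of_arrow X.of_out Y.of_out)
    refine (rep_curryHom X.of_out Z.of_out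
      ((hM.whiskerLeft X.of_out).comp (rep_evHom X.of_out Y.of_out))).of_eq hM ?_
    -- After β for projections, the body is the weakened `M` applied to the bound variable.
    refine .trans (.lam_eq ?_) (.lam_eta hM.typed)
    have hp : Th.HasType [X.out, Z.out] (.pair (.var 0) (.var 1)) (.prod X.out Z.out) :=
      .pair (.var rfl) (.var rfl)
    have hM' : Th.HasType [X.out, Z.out]
        ((M.replace (.snd (.var 0))).replace (.pair (.var 0) (.var 1))) (.arrow X.out Y.out) := by
      rw [Tm.replace_replace]
      exact hM.typed.sub_one (.snd hp)
    refine TmEq.app_eq ((TmEq.snd_beta (.fst hp) hM').trans ?_)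
      ((TmEq.fst_beta (.fst hp) hM').trans (.fst_beta (.var rfl) (.var rfl)))
    rw [Tm.replace_replace]
    exact .sub_one_wk hM.typed (.snd_beta (.var rfl) (.var rfl))

noncomputable instance : MonoidalClosed (SynCat Th) := (exponentials Th).monoidalClosed

end SynCat

theorem Rep.curry {X Y Z : SynCat Th} {f : X ⊗ Z ⟶ Y} {A B C : Th.Types} {M : Th.Terms}
    (hA : of A = X) (hC : of C = Z) (hf : Rep f (.prod A C) M B) :
    Rep (MonoidalClosed.curry f) C (.lam A (M.replace (.pair (.var 0) (.var 1))))
      (.arrow A B) := by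
  rw [(exponentials Th).curry_eq]
  exact rep_curryHom hA hC hf

theorem Rep.ev {X Y : SynCat Th} {A B : Th.Types} (hA : of A = X) (hB : of B = Y) :
    Rep ((ihom.ev X).app Y) (.prod A (.arrow A B)) (.app (.snd (.var 0)) (.fst (.var 0))) B := by
  rw [(exponentials Th).ev_app]
  exact rep_evHom hA hB

theorem isSyntacticCCC : IsSyntacticCCC Th where
  unit := rfl
  tensor _ _ := rfl
  fst _ _ := .fst rfl rfl
  snd _ _ := .snd rfl rfl
  exp _ _ := rfl
  ev _ _ := .ev rfl rfl

end Syntactic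
/-! ## The strong monads of the syntactic category -/

section SyntacticMonads

variable {Th : Theory.{u, v}}

open SynCat

/-- Turn a term in one variable of type `A × B` into a term in two variables. -/
def Tm.split {G : Type u} {K : Type v} (N : Tm G K) : Tm G K := N.replace (.pair (.var 1) (.var 0))

theorem HasType.split {A B C : Th.Types} {N : Th.Terms} (h : Th.HasType [.prod A B] N C) :
    Th.HasType [B, A] N.split C :=
  h.sub_one (.pair (.var rfl) (.var rfl))

theorem TmEq.split {A B C : Th.Types} {N N' : Th.Terms} (h : Th.TmEq [.prod A B] N N' C) :
    Th.TmEq [B, A] N.split N'.split C :=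
  h.sub_one (.refl (.pair (.var rfl) (.var rfl)))

namespace SynCat

theorem exists_bind {m : Mode} {G X Y : SynCat Th} (f : G ⟶ mon m X) (g : G ⊗ X ⟶ mon m Y) :
    ∃ h : G ⟶ mon m Y, ∀ {A B C M N}, of A = X → of B = Y → Rep f C M (.mon m A) →
      Rep g (.prod C A) N (.mon m B) → Rep h C (.bind m M N.split) (.mon m B) := by
  obtain ⟨M, hM⟩ := Rep.exists_tm f G.of_out (of_mon m X.of_out)
  obtain ⟨N, hN⟩ := Rep.exists_tm g (of_prod G.of_out X.of_out) (of_mon m Y.of_out)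
  refine ⟨_, fun {A B C M' N'} hA hB hf hg =>
    ((Rep.mk (.bind hM.typed hN.typed.split) G.of_out (of_mon m Y.of_out)).congr ?_).conv
      hf.dom_eq (of_mon m hB)⟩
  exact .bind_eq (hM.tmEq hf) (hN.tmEq hg).split

/-- The interpretation of `do` in the syntactic category. -/
noncomputable def bindHom {m : Mode} {G X Y : SynCat Th} (f : G ⟶ mon m X)
    (g : G ⊗ X ⟶ mon m Y) : G ⟶ mon m Y :=
  (exists_bind f g).choose

theorem rep_bindHom {m : Mode} {G X Y : SynCat Th} {f : G ⟶ mon m X} {g : G ⊗ X ⟶ mon m Y}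
    {A B C : Th.Types} {M N : Th.Terms} (hA : of A = X) (hB : of B = Y)
    (hf : Rep f C M (.mon m A)) (hg : Rep g (.prod C A) N (.mon m B)) :
    Rep (bindHom f g) C (.bind m M N.split) (.mon m B) :=
  (exists_bind f g).choose_spec hA hB hf hg

/-- The interpretation of `ret` in the syntactic category. -/
noncomputable def retHom (m : Mode) (X : SynCat Th) : X ⟶ mon m X :=
  Quotient.mk (judgementSetoid _ _)
    ⟨X.out, .ret m (.var 0), .mon m X.out, .ret m (.var rfl), X.of_out, of_mon m X.of_out⟩

theorem rep_retHom (m : Mode) {X : SynCat Th} {A : Th.Types} (hA : of A = X) :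
    Rep (retHom m X) A (.ret m (.var 0)) (.mon m A) :=
  (Rep.mk _ _ _).conv hA (of_mon m hA)

/-- The interpretation of `ι` in the syntactic category. -/
noncomputable def iotaHom (X : SynCat Th) : mon .S X ⟶ mon .T X :=
  Quotient.mk (judgementSetoid _ _)
    ⟨.mon .S X.out, .iota (.var 0), .mon .T X.out, .iota (.var rfl), of_mon _ X.of_out,
      of_mon _ X.of_out⟩

theorem rep_iotaHom {X : SynCat Th} {A : Th.Types} (hA : of A = X) :
    Rep (iotaHom X) (.mon .S A) (.iota (.var 0)) (.mon .T A) :=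
  (Rep.mk _ _ _).conv (of_mon _ hA) (of_mon _ hA)

/-- The strong monads of the syntactic category. -/
noncomputable def bindMonad (Th : Theory.{u, v}) (m : Mode) : BindMonad (SynCat Th) where
  obj := mon m
  η := retHom m
  bind := bindHom
  comp_bind {H G X Y} F f g := by
    obtain ⟨L, hL⟩ := Rep.exists_tm F H.of_out G.of_out
    obtain ⟨M, hM⟩ := Rep.exists_tm f G.of_out (of_mon m X.of_out)
    obtain ⟨N, hN⟩ := Rep.exists_tm g (of_prod G.of_out X.of_out) (of_mon m Y.of_out)
    refine (hL.comp (rep_bindHom X.of_out Y.of_out hM hN)).of_eq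
      (rep_bindHom X.of_out Y.of_out (hL.comp hM)
        (Rep.comp (((Rep.fst H.of_out X.of_out).comp hL).lift (.snd H.of_out X.of_out)) hN)) ?_
    refine .bind_eq (.refl (hL.typed.replace (.refl _) hM.typed)) ?_
    simp only [Tm.split, Tm.replace, Tm.sub_sub]
    -- Both continuations are substitution instances of `N`, so only the pair of environment and
    -- bound value that they feed to it has to be compared.
    refine .sub_one (.refl hN.typed) ?_
    change Th.TmEq _ (.pair L.wk (.var 0)) (.pair ((L.replace (.fst (.var 0))).replace _)
      (.snd (.pair (.var 1) (.var 0)))) _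
    rw [Tm.replace_replace]
    have hb := TmEq.fst_beta (Th := Th) (Γ := [X.out, H.out]) (M := .var 1) (N := .var 0)
      (.var rfl) (.var rfl)
    exact .pair_eq (TmEq.sub_one_wk hL.typed hb).symm
      (TmEq.snd_beta (.var (n := 1) rfl) (.var rfl)).symm
  bind_beta {G X Y} f g := by
    obtain ⟨M, hM⟩ := Rep.exists_tm f G.of_out X.of_out
    obtain ⟨N, hN⟩ := Rep.exists_tm g (of_prod G.of_out X.of_out) (of_mon m Y.of_out)
    refine (rep_bindHom X.of_out Y.of_out (hM.comp (rep_retHom m X.of_out)) hN).of_eq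
      (((Rep.id _ G.of_out).lift hM).comp hN) ?_
    refine (TmEq.bind_beta hM.typed hN.typed.split).trans ?_
    simp only [Tm.split, Tm.replace, Tm.inst, Tm.sub_sub]
    exact .sub_one (.refl hN.typed) (.refl (.pair (.var rfl) hM.typed))
  bind_eta {G X} f := by
    obtain ⟨M, hM⟩ := Rep.exists_tm f G.of_out (of_mon m X.of_out)
    refine (rep_bindHom X.of_out X.of_out hM
      ((Rep.snd G.of_out X.of_out).comp (rep_retHom m X.of_out))).of_eq hM ?_
    exact (TmEq.bind_eq (.refl hM.typed)
      (.ret_eq m (.snd_beta (.var (n := 1) rfl) (.var rfl)))).trans (.bind_eta hM.typed)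
  bind_assoc {G X Y Z} f g h := by
    obtain ⟨M, hM⟩ := Rep.exists_tm f G.of_out (of_mon m X.of_out)
    obtain ⟨N, hN⟩ := Rep.exists_tm g (of_prod G.of_out X.of_out) (of_mon m Y.of_out)
    obtain ⟨P, hP⟩ := Rep.exists_tm h (of_prod G.of_out Y.of_out) (of_mon m Z.of_out)
    have hGX := of_prod G.of_out X.of_out
    refine (rep_bindHom Y.of_out Z.of_out (rep_bindHom X.of_out Y.of_out hM hN) hP).of_eq
      (rep_bindHom X.of_out Z.of_out hM (rep_bindHom Y.of_out Z.of_out hN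
        ((((Rep.fst hGX Y.of_out).comp (.fst G.of_out X.of_out)).lift
          (.snd hGX Y.of_out)).comp hP))) ?_
    refine (TmEq.bind_assoc hM.typed hN.typed.split hP.typed.split).trans
      (.bind_eq (.refl hM.typed) (.bind_eq (.refl hN.typed.split) ?_))
    simp only [Tm.split, Tm.replace, Tm.sub_sub, Tm.ren_sub]
    refine .sub_one (.refl hP.typed) ?_
    -- Variable `2` is the environment, `1` the intermediate result that the last continuation
    -- ignores, and `0` the latest result.
    have h2 : Th.HasType [Y.out, X.out, G.out] (.var 2) G.out := .var rfl
    have h1 : Th.HasType [Y.out, X.out, G.out] (.var 1) X.out := .var rfl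
    have h0 : Th.HasType [Y.out, X.out, G.out] (.var 0) Y.out := .var rfl
    have h21 := HasType.pair h2 h1
    exact .symm (.pair_eq ((TmEq.fst_congr (.fst_beta h21 h0)).trans (.fst_beta h2 h1))
      (.snd_beta h21 h0))

/-- `S` is a central submonad of `T` in the syntactic category. -/
noncomputable def centralBind (Th : Theory.{u, v}) :
    CentralBind (bindMonad Th .S) (bindMonad Th .T) where
  ι := iotaHom
  mono X := ⟨fun {Z} f g e => by
    obtain ⟨M, hM⟩ := Rep.exists_tm f Z.of_out (of_mon .S X.of_out)
    obtain ⟨N, hN⟩ := Rep.exists_tm g Z.of_out (of_mon .S X.of_out)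
    refine hM.of_eq hN (.iota_mono hM.typed hN.typed ?_)
    exact Rep.tmEq (hM.comp (rep_iotaHom X.of_out)) (e ▸ hN.comp (rep_iotaHom X.of_out))⟩
  η_ι X := ((rep_retHom .S X.of_out).comp (rep_iotaHom X.of_out)).of_eq (rep_retHom .T X.of_out)
    (.iota_ret (.var rfl))
  bind_ι {G X Y} f g := by
    obtain ⟨M, hM⟩ := Rep.exists_tm f G.of_out (of_mon .S X.of_out)
    obtain ⟨N, hN⟩ := Rep.exists_tm g (of_prod G.of_out X.of_out) (of_mon .S Y.of_out)
    exact (rep_bindHom X.of_out Y.of_out (hM.comp (rep_iotaHom X.of_out))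
      (hN.comp (rep_iotaHom Y.of_out))).of_eq
      ((rep_bindHom X.of_out Y.of_out hM hN).comp (rep_iotaHom Y.of_out))
      (.iota_comp hM.typed hN.typed.split)
  central {G X Y Z} f g h := by
    obtain ⟨M, hM⟩ := Rep.exists_tm f G.of_out (of_mon .S X.of_out)
    obtain ⟨N, hN⟩ := Rep.exists_tm g G.of_out (of_mon .T Y.of_out)
    have hGX := of_prod G.of_out X.of_out
    have hGY := of_prod G.of_out Y.of_out
    obtain ⟨P, hP⟩ := Rep.exists_tm h (of_prod hGX Y.of_out) (of_mon .T Z.of_out)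
    refine (rep_bindHom X.of_out Z.of_out (hM.comp (rep_iotaHom X.of_out))
      (rep_bindHom Y.of_out Z.of_out ((Rep.fst G.of_out X.of_out).comp hN) hP)).of_eq
      (rep_bindHom Y.of_out Z.of_out hN
        (rep_bindHom X.of_out Z.of_out
          ((Rep.fst G.of_out Y.of_out).comp (hM.comp (rep_iotaHom X.of_out)))
          (Rep.comp (((((Rep.fst hGY X.of_out).comp (.fst G.of_out Y.of_out)).lift
            (.snd hGY X.of_out))).lift
            ((Rep.fst hGY X.of_out).comp (.snd G.of_out Y.of_out))) hP))) ?_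
    have hQ : Th.HasType [Y.out, X.out, G.out]
        (.pair (.pair (.var 2) (.var 1)) (.var 0)) (.prod (.prod G.out X.out) Y.out) :=
      .pair (.pair (.var rfl) (.var rfl)) (.var rfl)
    -- Pulling a term back along the projection to the environment amounts to the weakening that the
    -- rule `TmEq.central` demands.
    have hw : ∀ {A B : Th.Types} {K : Th.Terms}, Th.HasType [G.out] K B →
        Th.TmEq [A, G.out] ((K.replace (.fst (.var 0))).split) K.wk B := by
      intro A B K hK
      rw [Tm.split, Tm.replace_replace]
      exact .sub_one_wk hK (.fst_beta (.var rfl) (.var (n := 0) (A := A) rfl))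
    -- The left side is brought to the form of the centrality rule, the rule exchanges the two
    -- binds, and its result is matched with the right side.
    refine .trans (.bind_eq (.refl (.iota hM.typed)) (.bind_eq (hw hN.typed) ?_))
      (.trans (.central hM.typed hN.typed (hP.typed.sub_one (σ := Tm.headSub _) hQ))
      (.bind_eq (.refl hN.typed) (.bind_eq (.iota_eq (hw hM.typed).symm) ?_)))
    · simp only [Tm.split, Tm.replace, Tm.sub_sub]
      exact .sub_one (.refl hP.typed) (.refl hQ)
    · simp only [Tm.split, Tm.replace, Tm.sub_sub, Tm.ren_sub]
      refine .sub_one (.refl hP.typed) ?_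
      have h2 : Th.HasType [X.out, Y.out, G.out] (.var 2) G.out := .var rfl
      have h1 : Th.HasType [X.out, Y.out, G.out] (.var 1) Y.out := .var rfl
      have h0 : Th.HasType [X.out, Y.out, G.out] (.var 0) X.out := .var rfl
      have h21 := HasType.pair h2 h1
      exact .symm (.pair_eq (.pair_eq ((TmEq.fst_congr (.fst_beta h21 h0)).trans
        (.fst_beta h2 h1)) (.snd_beta h21 h0))
        ((TmEq.snd_congr (.fst_beta h21 h0)).trans (.snd_beta h2 h1)))

/-- The syntactic model. -/
noncomputable def model (Th : Theory.{u, v}) : CSCModel (SynCat Th) := (centralBind Th).toModel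

theorem model_mon (m : Mode) : (model Th).mon m = (bindMonad Th m).toStrongMonad := by
  cases m <;> rfl

/-- The operations derived from `bindHom` yield the prescribed terms up to projections of pairs,
which β removes. -/
theorem isSyntactic_bindMonad (m : Mode) :
    (bindMonad Th m).toStrongMonad.IsSyntactic m where
  obj _ := rfl
  map {A B M} f hf := by
    refine (rep_bindHom (m := m) hf.dom_eq hf.cod_eq (Rep.id (.mon m A) rfl)
      (Rep.comp ((Rep.snd rfl rfl).comp hf) (rep_retHom m rfl))).congr ?_
    refine .bind_eq (.refl (.var rfl)) (.ret_eq m ?_)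
    change Th.TmEq _ ((M.replace (.snd (.var 0))).replace _) M B
    rw [Tm.replace_replace]
    have h := TmEq.sub_one (Γ := [A, .mon m A]) (σ := Tm.headSub (.snd (.pair (.var 1) (.var 0))))
      (τ := .var) (.refl hf.typed) (.snd_beta (.var (n := 1) rfl) (.var rfl))
    rwa [Tm.sub_var] at h
  unit _ := rep_retHom m rfl
  mult A := by
    refine (rep_bindHom (m := m) rfl rfl (Rep.id (.mon m (.mon m A)) rfl)
      (Rep.snd rfl rfl)).congr ?_
    exact .bind_eq (.refl (.var rfl)) (.snd_beta (.var (n := 1) rfl) (.var rfl))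
  strength A B := by
    refine (rep_bindHom (m := m) rfl rfl (Rep.snd rfl rfl)
      (Rep.comp (((Rep.fst rfl rfl).comp (Rep.fst rfl rfl)).lift (.snd rfl rfl))
        (rep_retHom m rfl))).congr ?_
    have h1 : Th.HasType [B, .prod A (.mon m B)] (.var 1) (.prod A (.mon m B)) := .var rfl
    have h0 : Th.HasType [B, .prod A (.mon m B)] (.var 0) B := .var rfl
    exact .bind_eq (.refl (.snd (.var rfl))) (.ret_eq m
      (.pair_eq (.fst_congr (.fst_beta h1 h0)) (.snd_beta h1 h0)))

theorem isSyntactic_model : (model Th).IsSyntactic where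
  ccc := isSyntacticCCC
  T := isSyntactic_bindMonad .T
  S := isSyntactic_bindMonad .S
  ι _ := rep_iotaHom rfl

end SynCat
end SyntacticMonads
/-! ## The canonical interpretation -/

section Canonical

variable {Th : Theory.{u, v}}

open SynCat

/-- A context as a product type. -/
def ctxTy {G : Type u} : Ctx G → Ty G
  | [] => .one
  | A :: Γ => .prod (ctxTy Γ) A

/-- The component of an environment that gives the value of a variable. -/
def envSub {G : Type u} {K : Type v} : ℕ → Tm G K
  | 0 => .snd (.var 0)
  | n + 1 => (envSub n).replace (.fst (.var 0))

/-- The environment that consists of the variables of a context with `k` entries. -/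
def varTuple {G : Type u} {K : Type v} : ℕ → Tm G K
  | 0 => .star
  | k + 1 => .pair (varTuple k).wk (.var 0)

theorem envSub_typed {Γ : Th.Ctxs} : ∀ (n : ℕ) (A : Th.Types), Γ[n]? = some A →
    Th.HasType [ctxTy Γ] (envSub n) A := by
  induction Γ with
  | nil => intro n A h; simp at h
  | cons B Γ ih =>
    intro n A h
    cases n with
    | zero =>
      obtain rfl : B = A := by simpa using h
      exact .snd (.var rfl)
    | succ n => exact HasType.replace (.fst (.var rfl)) (.refl _) (ih n A h)

theorem varTuple_typed (Γ : Th.Ctxs) : Th.HasType Γ (varTuple Γ.length) (ctxTy Γ) := by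
  induction Γ with
  | nil => exact .star _
  | cons B Γ ih => exact .pair (ih.wk B) (.var rfl)

/-- By β, the projections of the tuple of variables are the variables. Packing a context is thus
reversible, and only this composite is needed. -/
theorem envSub_varTuple {Γ : Th.Ctxs} : ∀ (n : ℕ) (A : Th.Types), Γ[n]? = some A →
    Th.TmEq Γ ((envSub n).sub (Tm.headSub (varTuple Γ.length))) (.var n) A := by
  induction Γ with
  | nil => intro n A h; simp at h
  | cons B Γ ih =>
    intro n A h
    have hv : Th.HasType (B :: Γ) (varTuple Γ.length).wk (ctxTy Γ) := (varTuple_typed Γ).wk B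
    cases n with
    | zero =>
      obtain rfl : B = A := by simpa using h
      exact .snd_beta hv (.var rfl)
    | succ n =>
      have hn : Th.HasType [ctxTy Γ] (envSub n) A := envSub_typed n A h
      refine .trans ?_ ((ih n A h).wk B)
      rw [envSub, Tm.wk, Tm.ren_sub, Tm.replace, Tm.sub_sub]
      exact .sub_one (.refl hn) (.fst_beta hv (.var rfl))

theorem HasType.env {Γ : Th.Ctxs} {M : Th.Terms} {A : Th.Types} (h : Th.HasType Γ M A) :
    Th.HasType [ctxTy Γ] (M.sub envSub) A :=
  h.sub envSub_typed

/-- An equation in context is equivalent to the equation for environments. -/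
theorem tmEq_env_iff {Γ : Th.Ctxs} {M N : Th.Terms} {A : Th.Types} (hM : Th.HasType Γ M A)
    (hN : Th.HasType Γ N A) :
    Th.TmEq [ctxTy Γ] (M.sub envSub) (N.sub envSub) A ↔ Th.TmEq Γ M N A := by
  refine ⟨fun h => ?_, fun h => h.sub envSub_typed⟩
  -- Substituting the tuple of variables is a retraction of packing, so packing reflects provable
  -- equality.
  have back : ∀ {P : Th.Terms}, Th.HasType Γ P A →
      Th.TmEq Γ ((P.sub envSub).sub (Tm.headSub (varTuple Γ.length))) P A := by
    intro P hP
    have := hP.sub_congr (τ := .var) envSub_varTuple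
    rwa [Tm.sub_var, ← Tm.sub_sub] at this
  exact (back hM).symm.trans ((TmEq.sub_one h (.refl (varTuple_typed Γ))).trans (back hN))

theorem ctxTy_congr {Γ Δ : Th.Ctxs} (h : Th.CtxEq Γ Δ) : Th.TyEq (ctxTy Γ) (ctxTy Δ) := by
  induction h with
  | nil => exact .refl _
  | cons h _ ih => exact .prod ih h

/-- The canonical interpretation of ground types. -/
def groundObj (Th : Theory.{u, v}) (g : Th.Ground) : SynCat Th := of (.ground g)

/-- Each type denotes its own class, so for types soundness and completeness are just the definition
of objects as a quotient. -/
theorem model_ty (A : Th.Types) : (model Th).ty (groundObj Th) A = of A := by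
  induction A with
  | ground g => rfl
  | one => rfl
  | arrow A B ihA ihB =>
    exact (congrArg₂ arrow ihA ihB).trans (of_arrow rfl rfl).symm
  | prod A B ihA ihB =>
    exact (congrArg₂ SynCat.prod ihA ihB).trans (of_prod rfl rfl).symm
  | mon m A ih =>
    change ((model Th).mon m).obj _ = _
    rw [model_mon, ih]
    rfl

theorem model_ctx (Γ : Th.Ctxs) : (model Th).ctx (groundObj Th) Γ = of (ctxTy Γ) := by
  induction Γ with
  | nil => rfl
  | cons A Γ ih =>
    exact (congrArg₂ SynCat.prod ih (model_ty A)).trans (of_prod rfl rfl).symm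

/-- The canonical interpretation of a term. -/
noncomputable def tmHom {Γ : Th.Ctxs} {M : Th.Terms} {A : Th.Types} (h : Th.HasType Γ M A) :
    (model Th).ctx (groundObj Th) Γ ⟶ (model Th).ty (groundObj Th) A :=
  Quotient.mk (judgementSetoid _ _)
    ⟨ctxTy Γ, M.sub envSub, A, h.env, (model_ctx Γ).symm, (model_ty A).symm⟩

theorem rep_tmHom {Γ : Th.Ctxs} {M : Th.Terms} {A : Th.Types} (h : Th.HasType Γ M A) :
    Rep (tmHom h) (ctxTy Γ) (M.sub envSub) A :=
  Rep.mk _ _ _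

/-- This is the step under a binder: once the bound variable is split off, the packed environment of
`A :: Γ` β-reduces to that of `Γ` lifted under the binder. -/
theorem split_env {Γ : Th.Ctxs} {A B : Th.Types} {N : Th.Terms} (h : Th.HasType (A :: Γ) N B) :
    Th.TmEq [A, ctxTy Γ] (N.sub envSub).split (N.sub (Tm.up envSub)) B := by
  rw [Tm.split, Tm.replace, Tm.sub_sub]
  refine h.sub_congr fun n C hn => ?_
  cases n with
  | zero =>
    obtain rfl : A = C := by simpa using hn
    exact .snd_beta (.var (n := 1) rfl) (.var rfl)
  | succ n =>
    have hC := envSub_typed (Γ := Γ) n C hn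
    change Th.TmEq _ (((envSub n).replace _).replace _) (envSub n).wk C
    rw [Tm.replace_replace]
    exact .sub_one_wk hC (.fst_beta (.var rfl) (.var (n := 0) rfl))

theorem model_bind {m : Mode} {G X Y : SynCat Th} (f : G ⟶ ((model Th).mon m).obj X)
    (g : G ⊗ X ⟶ ((model Th).mon m).obj Y) {A B C : Th.Types} {M N : Th.Terms}
    (hA : of A = X) (hB : of B = Y) (hf : Rep f C M (.mon m A))
    (hg : Rep g (.prod C A) N (.mon m B)) :
    Rep (lift (𝟙 G) f ≫ ((model Th).mon m).τ G X ≫ ((model Th).mon m).map g ≫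
      ((model Th).mon m).μ.app Y) C (.bind m M N.split) (.mon m B) := by
  revert f g
  rw [model_mon]
  intro f g hf hg
  have := (bindMonad Th m).bind_eq f g
  exact this ▸ rep_bindHom hA hB hf hg

theorem model_ret (m : Mode) {X : SynCat Th} {A : Th.Types} (hA : of A = X) :
    Rep (((model Th).mon m).η.app X) A (.ret m (.var 0)) (.mon m A) := by
  rw [model_mon]
  exact rep_retHom m hA

/-- The canonical interpretation. -/
noncomputable def canonical (Th : Theory.{u, v}) : Interpretation Th (model Th) where
  ground := groundObj Th
  tm := tmHom
  conv {Γ Δ M A B} hΓ hA h h' eΓ eA :=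
    (rep_tmHom h').of_eq ((Rep.eqToHom eΓ _ (model_ctx Δ).symm).comp
      (((rep_tmHom h).conv ((model_ctx Δ).symm.trans eΓ) (model_ty A).symm).comp
        (Rep.eqToHom eA _ (model_ty A).symm))) (by
      -- An `eqToHom` is represented by a variable, so transport along type equality leaves the term
      -- unchanged.
      change Th.TmEq _ _ ((M.sub envSub).replace (.var 0)) _
      rw [Tm.replace_var]
      exact .refl h'.env)
  var_zero {Γ A} h := (rep_tmHom h).of_eq
    (Rep.snd (model_ctx Γ).symm (model_ty A).symm) (.refl h.env)
  var_succ {Γ A B n} h h' := (rep_tmHom h').of_eq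
    ((Rep.fst (model_ctx Γ).symm (model_ty B).symm).comp (rep_tmHom h)) (.refl h'.env)
  const {Γ c} h h' := (rep_tmHom h').of_eq
    ((Rep.toUnit (model_ctx Γ).symm).comp (rep_tmHom h)) (.refl h'.env)
  star {Γ} h := (rep_tmHom h).of_eq (Rep.toUnit (model_ctx Γ).symm) (.refl h.env)
  lam {Γ A B M} h h' := by
    refine (rep_tmHom h').of_eq (Rep.curry (model_ty A).symm (model_ctx Γ).symm
      (((Rep.snd (model_ty A).symm (model_ctx Γ).symm).lift
        (.fst (model_ty A).symm (model_ctx Γ).symm)).comp (rep_tmHom h))) ?_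
    have hp : Th.HasType [A, ctxTy Γ] (.pair (.var 0) (.var 1)) (.prod A (ctxTy Γ)) :=
      .pair (.var rfl) (.var rfl)
    refine .lam_eq ((split_env h).symm.trans ?_)
    rw [Tm.replace_replace]
    exact .symm (.sub_one (.refl h.env) (.pair_eq
      (.snd_beta (.var (n := 0) (A := A) rfl) (.var rfl)) (.fst_beta (.var rfl)
        (.var (n := 1) (A := ctxTy Γ) rfl))))
  app {Γ A B M N} hM hN h := by
    refine (rep_tmHom h).of_eq (((rep_tmHom hN).lift (rep_tmHom hM)).comp
      (Rep.ev (model_ty A).symm (model_ty B).symm)) ?_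
    exact .symm (.app_eq (.snd_beta hN.env hM.env) (.fst_beta hN.env hM.env))
  pair hM hN h := (rep_tmHom h).of_eq ((rep_tmHom hM).lift (rep_tmHom hN)) (.refl h.env)
  fst {Γ A B M} hM h := (rep_tmHom h).of_eq
    ((rep_tmHom hM).comp (.fst (model_ty A).symm (model_ty B).symm)) (.refl h.env)
  snd {Γ A B M} hM h := (rep_tmHom h).of_eq
    ((rep_tmHom hM).comp (.snd (model_ty A).symm (model_ty B).symm)) (.refl h.env)
  ret {m Γ A M} hM h := (rep_tmHom h).of_eq
    ((rep_tmHom hM).comp (model_ret m (model_ty A).symm)) (.refl h.env)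
  iota {Γ A M} hM h := (rep_tmHom h).of_eq
    ((rep_tmHom hM).comp (rep_iotaHom (model_ty A).symm)) (.refl h.env)
  bind {m Γ A B M N} hM hN h := (rep_tmHom h).of_eq
    (model_bind _ _ (model_ty A).symm (model_ty B).symm (rep_tmHom hM) (rep_tmHom hN))
    (.bind_eq (.refl hM.env) (split_env hN).symm)

theorem canonical_isCanonical : (canonical Th).IsCanonical where
  ground _ := rfl
  const _ h := rep_tmHom h

/-! ### Soundness, completeness and uniqueness -/

theorem canonical_ty_iff (A B : Th.Types) :
    Th.TyEq A B ↔ (canonical Th).ty A = (canonical Th).ty B := by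
  change _ ↔ (model Th).ty (groundObj Th) A = (model Th).ty (groundObj Th) B
  rw [model_ty, model_ty, of_eq_iff]

theorem canonical_tm_iff {Γ : Th.Ctxs} {M N : Th.Terms} {A : Th.Types} (hM : Th.HasType Γ M A)
    (hN : Th.HasType Γ N A) :
    Th.TmEq Γ M N A ↔ (canonical Th).tm hM = (canonical Th).tm hN := by
  rw [← tmEq_env_iff hM hN]
  exact ⟨fun h => (rep_tmHom hM).of_eq (rep_tmHom hN) h,
    fun h => (rep_tmHom hM).tmEq (show Rep (tmHom hM) _ _ _ from
      (show tmHom hM = tmHom hN from h) ▸ rep_tmHom hN)⟩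

theorem model_ctx_congr {Γ Δ : Th.Ctxs} (h : Th.CtxEq Γ Δ) :
    (model Th).ctx (groundObj Th) Δ = (model Th).ctx (groundObj Th) Γ := by
  rw [model_ctx, model_ctx, of_eq_iff]
  exact ctxTy_congr h.symm

/-- The canonical interpretation is determined by its values on ground types and constants. -/
theorem canonical_unique (J : Interpretation Th (model Th)) (hJ : J.IsCanonical) :
    J = canonical Th := by
  obtain ⟨hg, hc⟩ := hJ
  have e : J.ground = groundObj Th := funext hg
  -- Until the two interpretations of ground types are identified, the morphisms live in different
  -- Hom-sets, hence `HEq`.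
  suffices H : ∀ {Γ : Th.Ctxs} {M : Th.Terms} {A : Th.Types} (h : Th.HasType Γ M A),
      HEq (J.tm h) (tmHom h) by
    cases J
    cases e
    simp only [canonical, Interpretation.mk.injEq]
    refine ⟨rfl, heq_of_eq ?_⟩
    funext Γ M A h
    exact eq_of_heq (H h)
  obtain ⟨g, tm, conv, var_zero, var_succ, const, star, lam, app, pair, fst, snd, ret, iota,
    bind⟩ := J
  cases e
  intro Γ M A h
  refine heq_of_eq ?_
  dsimp only at *
  let K := canonical Th
  induction h with
  | @var Γ n A h =>
    induction Γ generalizing n with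
    | nil => simp at h
    | cons B Γ ih =>
      cases n with
      | zero =>
        obtain rfl : B = A := by simpa using h
        exact (var_zero (.var h)).trans (K.var_zero (.var h)).symm
      | succ n =>
        have h' : Γ[n]? = some A := h
        exact (var_succ (.var h') (.var h)).trans
          ((congrArg (_ ≫ ·) (ih h')).trans (K.var_succ (.var h') (.var h)).symm)
  | const Γ c =>
    -- Canonicity fixes a constant in the empty context only; the clause for constants carries this
    -- to `Γ`.
    refine (const (.const [] c) (.const Γ c)).trans ((congrArg (_ ≫ ·) ?_).trans
      (K.const (.const [] c) (.const Γ c)).symm)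
    exact (hc c (.const [] c)).of_eq (rep_tmHom (.const [] c)) (.refl (.const _ _))
  | star Γ => exact (star (.star Γ)).trans (K.star (.star Γ)).symm
  | lam h ih =>
    exact (lam h (.lam h)).trans
      ((congrArg (fun f => MonoidalClosed.curry (symm _ _ ≫ f)) ih).trans (K.lam h (.lam h)).symm)
  | app h1 h2 ih1 ih2 =>
    exact (app h1 h2 (.app h1 h2)).trans ((congrArg₂ (fun f g => lift g f ≫ _) ih1 ih2).trans
      (K.app h1 h2 (.app h1 h2)).symm)
  | pair h1 h2 ih1 ih2 =>
    exact (pair h1 h2 (.pair h1 h2)).trans ((congrArg₂ CartesianMonoidalCategory.lift ih1 ih2).trans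
      (K.pair h1 h2 (.pair h1 h2)).symm)
  | fst h ih => exact (fst h (.fst h)).trans ((congrArg (· ≫ _) ih).trans (K.fst h (.fst h)).symm)
  | snd h ih => exact (snd h (.snd h)).trans ((congrArg (· ≫ _) ih).trans (K.snd h (.snd h)).symm)
  | ret m h ih => exact (ret h (.ret m h)).trans ((congrArg (· ≫ _) ih).trans (K.ret h (.ret m h)).symm)
  | iota h ih => exact (iota h (.iota h)).trans ((congrArg (· ≫ _) ih).trans (K.iota h (.iota h)).symm)
  | @bind m Γ A B M N h1 h2 ih1 ih2 =>
    exact (bind h1 h2 (.bind h1 h2)).trans ((congrArg₂ (fun f g => lift (𝟙 _) f ≫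
      ((model Th).mon m).τ _ _ ≫ ((model Th).mon m).map g ≫ ((model Th).mon m).μ.app _)
      ih1 ih2).trans (K.bind h1 h2 (.bind h1 h2)).symm)
  | @conv Γ Δ M A B hΓ hA h ih =>
    -- The conversion clause assumes the equalities of objects; they hold because the objects depend
    -- only on the ground types, which are now shared.
    have eA := (canonical_ty_iff A B).1 hA
    have eΓ := model_ctx_congr hΓ
    exact (conv hΓ hA h (.conv hΓ hA h) eΓ eA).trans
      ((congrArg (fun f => CategoryTheory.eqToHom eΓ ≫ f ≫ CategoryTheory.eqToHom eA) ih).trans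
        (K.conv hΓ hA h (.conv hΓ hA h) eΓ eA).symm)

end Canonical
end CSC

theorem theorem6 (Th : CSC.Theory.{u, v}) :
    ∃ (_ : CartesianMonoidalCategory (CSC.SynCat Th)) (_ : MonoidalClosed (CSC.SynCat Th))
      (𝓜 : CSC.CSCModel (CSC.SynCat Th)),
      𝓜.IsSyntactic ∧
      (∀ X : CSC.SynCat Th, Mono (𝓜.ι.app X)) ∧
      ∃ I : CSC.Interpretation Th 𝓜,
        I.IsCanonical ∧
        (∀ J : CSC.Interpretation Th 𝓜, J.IsCanonical → J = I) ∧
        I.Sound ∧ I.Complete := by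
  refine ⟨inferInstance, inferInstance, CSC.SynCat.model Th, CSC.SynCat.isSyntactic_model,
    (CSC.SynCat.centralBind Th).mono, CSC.canonical Th, CSC.canonical_isCanonical,
    CSC.canonical_unique, ⟨fun A B h => (CSC.canonical_ty_iff A B).1 h, ?_⟩,
    CSC.canonical_ty_iff, ?_⟩
  · intro Γ M N A h hM hN
    exact (CSC.canonical_tm_iff hM hN).1 h
  · intro Γ M N A hM hN
    exact CSC.canonical_tm_iff hM hN
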